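/- Let $(Y,p)$ be a probability space, $(X,\mu)$ a standard Borel probability space and $G$ a locally compact, Hausdorff, second countable topological group with its Borel $\sigma$-algebra. Put $\Omega=Y^{\mathbb Z}$, $\mathbb P=p^{\mathbb Z}$, let $\theta$ be the left shift on $\Omega$, and put $\bar X=\Omega\times X$, $\bar\mu=\mathbb P\times\mu$. Let $\bar f(\omega,x)=(\theta\omega,f_{\omega_0}(x))$ be an invertible bimeasurable transformation of $\bar X$ that preserves $\bar\mu$ and is ergodic for it. A random cocycle $(\bar f,A)$ with values in $G$ is given by a measurable map $(i,x)\mapsto A_i(x)$ from $Y\times X$ to $G$; write $A(\omega,x)=A_{\omega_0}(x)$ and $A^n(\bar x)=A(\bar f^{\,n-1}(\bar x))\cdots A(\bar f(\bar x))A(\bar x)$, $A^0=\mathrm{id}$. It is *essentially bounded* if there are a compact set $K\subset G$, a constant $\delta>0$ and a measurable set $E\subset\bar X$ with $\bar\mu(E)>0$ such that $$\liminf_{n\to\infty}\frac1n\,\#\{0\le k\le n: A^k(\bar x)\in K\}\ge\delta\quad\text{for all }\bar x\in E.$$ Two random cocycles $(\bar f,A)$ and $(\bar f,B)$ are *cohomologous*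 if there is a measurable $P:X\to G$ with $B(\omega,x)=P(f_{\omega_0}(x))^{-1}A(\omega,x)P(x)$ for $\bar\mu$-almost every $(\omega,x)$. If the group of values acts on a space $Z$, put $F_i(x,z)=(f_i(x),A_i(x)z)$ on $X\times Z$. A measure $\hat\pi$ on $X\times Z$ is *$(\bar f,A)$-stationary* if it projects on $\mu$ and $\int_Y (F_i)_*\hat\pi\,dp(i)=\hat\pi$, and *$(\bar f,A)$-invariant* if it projects on $\mu$ and $(F_i)_*\hat\pi=\hat\pi$ for $p$-almost every $i$. **Theorem.** Let $(\bar f,A)$ be an essentially bounded random $G$-valued cocycle. Then there are a compact subgroup $H$ of $G$ and a random cocycle $(\bar f,B)$ with values in $H$ such that, $m_H$ denoting the Haar probability measure of $H$: 1. $(\bar f,A)$ is cohomologous to $(\bar f,B)$ (as $G$-valued cocycles); 2. $\mu\times m_H$ is the unique $(\bar f,B)$-stationary probability measure on $X\times H$, and it is $(\bar f,B)$-invariant; 3. every $(\bar f,B)$-stationary probability measure $\hat\pi$ on $X\times G$ is a product $\hat\pi=\mu\times(m_H*\omega)$ for some probability measure $\omega$ on $G$, and it is $(\bar f,B)$-invariant.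 In particular, every $(\bar f,A)$-stationary probability measure on $X\times G$ is $(\bar f,A)$-invariant. -/

import Mathlib

open MeasureTheory Filter
open scoped MeasureTheory

noncomputable section

namespace RandomCocycle

/-- The lower asymptotic density `liminf_n #([0, n] ∩ D) / n` of a set of natural numbers. -/
def lowerDensity (D : Set ℕ) : ℝ :=
  liminf (fun n : ℕ => ((Set.Icc 0 n ∩ D).ncard : ℝ) / (n : ℝ)) atTop

/-- The products `a (T^(n-1) s) ⋯ a (T s) a s` of a cocycle `(T, a)`. -/
def iter {S G : Type*} [Group G] (T : S → S) (a : S → G) : ℕ → S → G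
  | 0, _ => 1
  | n + 1, s => a (T^[n] s) * iter T a n s

section

variable {Y X G Z : Type*} [MeasurableSpace Y] [MeasurableSpace X]

/-- The skew-shift `(ω, x) ↦ (θ ω, f_{ω 0} x)` on `Y^ℤ × X`, with `θ` the left shift. -/
def skewShift (f : Y → X → X) (q : (ℤ → Y) × X) : (ℤ → Y) × X :=
  (fun n => q.1 (n + 1), f (q.1 0) q.2)

/-- The measure `p^ℤ × μ` on `Y^ℤ × X`. -/
def baseMeasure (p : Measure Y) [IsProbabilityMeasure p] (μ : Measure X) :
    Measure ((ℤ → Y) × X) :=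
  (Measure.infinitePi fun _ : ℤ => p).prod μ

/-- The family `f` defines a random transformation: its skew-shift is invertible (measurable,
with a measurable inverse), and preserves the measure `p^ℤ × μ`, which is ergodic for it. -/
structure IsRandomTransformation (p : Measure Y) [IsProbabilityMeasure p] (μ : Measure X)
    (f : Y → X → X) : Prop where
  invertible : ∃ e : ((ℤ → Y) × X) ≃ᵐ ((ℤ → Y) × X), ⇑e = skewShift f
  ergodic : Ergodic (skewShift f) (baseMeasure p μ)

/-- `(f, A)` is a random `G`-valued cocycle; the generator at `(ω, x)` is `A (ω 0) x`. -/
structure IsRandomCocycle [MeasurableSpace G] (p : Measure Y) [IsProbabilityMeasure p]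
    (μ : Measure X) (f : Y → X → X) (A : Y → X → G) : Prop where
  base : IsRandomTransformation p μ f
  measurable : Measurable fun q : Y × X => A q.1 q.2

/-- The generator of a random cocycle, as a function on `Y^ℤ × X`. -/
def generator (A : Y → X → G) (q : (ℤ → Y) × X) : G := A (q.1 0) q.2

/-- Essential boundedness: for some compact `K` and some `δ > 0`, the times `n ≥ 0` with
`A^n (ω, x) ∈ K` have lower density at least `δ` for all `(ω, x)` in a set of positive measure. -/
def EssentiallyBounded [Group G] [TopologicalSpace G] (p : Measure Y) [IsProbabilityMeasure p]
    (μ : Measure X) (f : Y → X → X) (A : Y → X → G) : Prop :=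
  ∃ K : Set G, IsCompact K ∧ ∃ δ : ℝ, 0 < δ ∧ ∃ E : Set ((ℤ → Y) × X),
    MeasurableSet E ∧ 0 < baseMeasure p μ E ∧
      ∀ q ∈ E, δ ≤ lowerDensity {n : ℕ | iter (skewShift f) (generator A) n q ∈ K}

/-- Cohomologous random cocycles: the conjugacy `P` depends on `x` only. -/
def Cohomologous [Group G] [MeasurableSpace G] (p : Measure Y) [IsProbabilityMeasure p]
    (μ : Measure X) (f : Y → X → X) (A B : Y → X → G) : Prop :=
  ∃ P : X → G, Measurable P ∧
    ∀ᵐ q ∂(baseMeasure p μ), B (q.1 0) q.2 = (P (f (q.1 0) q.2))⁻¹ * A (q.1 0) q.2 * P q.2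

/-- The maps `F_i (x, z) = (f_i x, A_i x • z)` on `X × Z`. -/
def skewMap [SMul G Z] (f : Y → X → X) (A : Y → X → G) (i : Y) (q : X × Z) : X × Z :=
  (f i q.1, A i q.1 • q.2)

/-- `π` projects on `μ` and is `F_i`-invariant for `p`-almost every `i`. -/
structure IsInvariant [SMul G Z] [MeasurableSpace Z] (p : Measure Y) (μ : Measure X)
    (f : Y → X → X) (A : Y → X → G) (π : Measure (X × Z)) : Prop where
  proj : π.map Prod.fst = μ
  invariant : ∀ᵐ i ∂p, π.map (skewMap f A i) = π

/-- `π` projects on `μ` and `∫ F_i π dp(i) = π`. -/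
structure IsStationary [SMul G Z] [MeasurableSpace Z] (p : Measure Y) (μ : Measure X)
    (f : Y → X → X) (A : Y → X → G) (π : Measure (X × Z)) : Prop where
  proj : π.map Prod.fst = μ
  stationary : ∀ S : Set (X × Z), MeasurableSet S →
    ∫⁻ i, π.map (skewMap f A i) S ∂p = π S

end

/-- The Haar measure of total mass one on a compact group. -/
def haarProb (H : Type*) [Group H] [TopologicalSpace H] [IsTopologicalGroup H] [CompactSpace H]
    [MeasurableSpace H] [BorelSpace H] : Measure H :=
  Measure.haarMeasure ⊤

end RandomCocycle

end

/-!
The theorem is proved on the skew product `X × G`, with the measure `ρ = μ × m`, where `m` is a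
left Haar measure of `G`. The maps `F_i (x, u) = (f_i x, A_i x * u)` preserve `ρ` for almost every `i`,
and commute with right translations of `G`.

*Invariant functions.* The Markov operator `T h = ∫ h ∘ F_i dp(i)` is a contraction of `L²(ρ)`, and
an average of vectors `h ∘ F_i` of norm `‖h‖` is equal to `h` only if almost all of them are
equal to `h` (`mem_invariantL2_of_inner_eq`). So the fixed vectors of `T` are the functions with
`h ∘ F_i = h` for almost every `i`; they make up `invariantL2`. Essential boundedness says that the
walk returns to a set of finite measure with positive frequency, and by the mean ergodic theorem
`T` has a nonzero fixed vector (`EssentiallyBounded.exists_mem_invariantL2_ne_zero`).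

*Reduction.* Take a dense sequence `h_j` of invariant functions. The map `Φ x = (h_j (x, ·))_j`,
with values in sequences in `L²(G)`, is equivariant for the regular representation, which is proper away
from `0`. Ergodicity and properness force almost all `Φ x` into the orbit of one point `v₀`
(`IsRandomTransformation.exists_measurable_orbit_map`), and a measurable selection gives
`P : X → G` with `Φ x = v₀ ∘ (P x)⁻¹`. The stabilizer `H` of `v₀` is compact, the cocycle
`B_i x = (P (f_i x))⁻¹ * A_i x * P x` takes values in `H`, and after conjugation by `P` every
invariant function depends on `u` only and is invariant under left translation by `H`
(`EssentiallyBounded.exists_reduction`). The use of all invariant functions at once is what makes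
`H` small enough for uniqueness.

*Stationary measures.* If `π` is a stationary probability measure on `X × G`, its convolutions from
the right with `m` restricted to sets `V` of finite measure are stationary and bounded by `ρ`, so
their densities are invariant functions. For the cocycle `B` these convolutions are therefore
products of `μ` with `H`-invariant measures, and since they determine `π`
(`eq_of_forall_smoothing_eq`), so is `π` (`IsStationary.eq_prod`). The statements about stationary
measures all follow from this, using that `A` and `B` are conjugate for the last one.
-/

noncomputable section

open scoped ENNReal Topology Pointwise

set_option linter.unusedSectionVars false

namespace RandomCocycle

/-! ### Families of measures -/

/-- Families of finite measures on a countably generated space which agree almost surely on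
each measurable set agree almost surely: only countably many sets have to be tested. -/
theorem ae_measure_eq_of_forall_ae_apply_eq {I Z : Type*} [MeasurableSpace I] [MeasurableSpace Z]
    [MeasurableSpace.CountablyGenerated Z] {p : Measure I} {κ₁ κ₂ : I → Measure Z}
    (h₁ : ∀ i, IsFiniteMeasure (κ₁ i))
    (h : ∀ S, MeasurableSet S → ∀ᵐ i ∂p, κ₁ i S = κ₂ i S) : ∀ᵐ i ∂p, κ₁ i = κ₂ i := by
  set C := generateSetAlgebra (MeasurableSpace.countableGeneratingSet Z) with hC
  have hCc : C.Countable :=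
    countable_generateSetAlgebra (MeasurableSpace.countable_countableGeneratingSet)
  have hgen : MeasurableSpace.generateFrom C = ‹MeasurableSpace Z› := by
    rw [hC, generateFrom_generateSetAlgebra_eq, MeasurableSpace.generateFrom_countableGeneratingSet]
  have hmeas : ∀ S ∈ C, MeasurableSet S := fun S hS => by
    rw [← hgen]; exact MeasurableSpace.measurableSet_generateFrom hS
  have halg : IsSetAlgebra C := isSetAlgebra_generateSetAlgebra
  have hpi : IsPiSystem C := fun s hs t ht _ => halg.inter_mem hs ht
  have hall : ∀ᵐ i ∂p, ∀ S ∈ C, κ₁ i S = κ₂ i S :=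
    (ae_ball_iff hCc).2 fun S hS => h S (hmeas S hS)
  filter_upwards [hall] with i hi
  have := h₁ i
  exact ext_of_generate_finite C hgen.symm hpi hi (hi _ halg.univ_mem)

/-- Resampling one coordinate does not change a product of copies of one law. -/
theorem measurePreserving_update_infinitePi {Y : Type*} [MeasurableSpace Y] (p : Measure Y)
    [IsProbabilityMeasure p] (n : ℤ) :
    MeasurePreserving (fun q : Y × (ℤ → Y) => Function.update q.2 n q.1)
      (p.prod (Measure.infinitePi fun _ : ℤ => p)) (Measure.infinitePi fun _ : ℤ => p) := by
  classical
  have hm : Measurable (fun q : Y × (ℤ → Y) => Function.update q.2 n q.1) := by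
    rw [measurable_pi_iff]
    intro k
    by_cases hk : k = n
    · subst hk; simpa using measurable_fst
    · simpa [hk, Function.comp_def] using (measurable_pi_apply k).comp measurable_snd
  refine ⟨hm, Measure.eq_infinitePi _ fun s t ht => ?_⟩
  rw [Measure.map_apply hm (MeasurableSet.pi s.countable_toSet fun i _ => ht i)]
  have hpre : (fun q : Y × (ℤ → Y) => Function.update q.2 n q.1) ⁻¹' (Set.pi s t)
      = (if n ∈ s then t n else Set.univ) ×ˢ (Set.pi (s.erase n : Finset ℤ) t) := by
    ext q
    simp only [Set.mem_preimage, Set.mem_pi, Finset.mem_coe, Set.mem_prod, Finset.mem_erase]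
    constructor
    · intro h
      refine ⟨?_, fun i hi => by simpa [hi.1] using h i hi.2⟩
      split_ifs with hn
      · simpa using h n hn
      · trivial
    · rintro ⟨h1, h2⟩ i hi
      by_cases hin : i = n
      · subst hin; simpa [hi] using h1
      · simpa [hin] using h2 i ⟨hin, hi⟩
  rw [hpre, Measure.prod_prod, Measure.infinitePi_pi _ fun i _ => ht i]
  split_ifs with hn
  · exact Finset.mul_prod_erase s (fun i => p (t i)) hn
  · simp [Finset.erase_eq_of_notMem hn]

/-! ### Random transformations -/

section Base

variable {Y X : Type*} [MeasurableSpace Y] [MeasurableSpace X]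
  {p : Measure Y} [IsProbabilityMeasure p] {μ : Measure X} [IsProbabilityMeasure μ]
  {f : Y → X → X}

theorem IsRandomTransformation.measurable_skewShift (hf : IsRandomTransformation p μ f) :
    Measurable (skewShift f) := by
  obtain ⟨e, he⟩ := hf.invertible
  rw [← he]; exact e.measurable

theorem IsRandomTransformation.measurable (hf : IsRandomTransformation p μ f) :
    Measurable fun q : Y × X => f q.1 q.2 := by
  have h : Measurable fun q : Y × X => ((fun _ => q.1 : ℤ → Y), q.2) :=
    (measurable_pi_lambda _ fun _ => measurable_fst).prodMk measurable_snd
  exact measurable_snd.comp (hf.measurable_skewShift.comp h)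

theorem measurePreserving_fst_coord (p : Measure Y) [IsProbabilityMeasure p] (μ : Measure X)
    [IsProbabilityMeasure μ] (n : ℤ) :
    MeasurePreserving (fun q : (ℤ → Y) × X => (q.1 n, q.2)) (baseMeasure p μ) (p.prod μ) :=
  (measurePreserving_eval_infinitePi (fun _ : ℤ => p) n).prod (MeasurePreserving.id μ)

/-- The coordinate `-1` of `θ ω` is `ω 0`, so invariance of `p^ℤ × μ` under the skew-shift gives
invariance of `p × μ` under `(i, x) ↦ (i, f_i x)`. -/
theorem IsRandomTransformation.measurePreserving_prodMk (hf : IsRandomTransformation p μ f) :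
    MeasurePreserving (fun q : Y × X => (q.1, f q.1 q.2)) (p.prod μ) (p.prod μ) := by
  have hm : Measurable (fun q : Y × X => (q.1, f q.1 q.2)) :=
    measurable_fst.prodMk hf.measurable
  refine ⟨hm, ?_⟩
  have h0 := measurePreserving_fst_coord p μ 0
  have h1 := (measurePreserving_fst_coord p μ (-1)).comp hf.ergodic.toMeasurePreserving
  conv_lhs => rw [← h0.map_eq]
  rw [Measure.map_map hm h0.measurable, ← h1.map_eq]
  congr 1

theorem IsRandomTransformation.measurePreserving (hf : IsRandomTransformation p μ f) :
    MeasurePreserving (fun q : Y × X => f q.1 q.2) (p.prod μ) μ :=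
  measurePreserving_snd.comp hf.measurePreserving_prodMk

theorem IsRandomTransformation.measurable_apply (hf : IsRandomTransformation p μ f) (i : Y) :
    Measurable (f i) :=
  hf.measurable.comp measurable_prodMk_left

theorem IsRandomTransformation.ae_measurePreserving [MeasurableSpace.CountablyGenerated X]
    (hf : IsRandomTransformation p μ f) : ∀ᵐ i ∂p, MeasurePreserving (f i) μ μ := by
  have key : ∀ᵐ i ∂p, μ.map (f i) = μ := by
    refine ae_measure_eq_of_forall_ae_apply_eq
      (fun i => Measure.isFiniteMeasure_map μ (f i)) fun S hS => ?_
    have hpre : MeasurableSet ((fun q : Y × X => f q.1 q.2) ⁻¹' S) := hf.measurable hS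
    have hmeas : Measurable fun i => μ.map (f i) S := by
      simp only [Measure.map_apply (hf.measurable_apply _) hS]
      exact measurable_measure_prodMk_left hpre
    refine ae_eq_of_forall_setLIntegral_eq_of_sigmaFinite hmeas measurable_const
      fun J hJ _ => ?_
    have h := hf.measurePreserving_prodMk.measure_preimage (hJ.prod hS).nullMeasurableSet
    rw [Measure.prod_prod, Measure.prod_apply
      (hf.measurePreserving_prodMk.measurable (hJ.prod hS))] at h
    rw [setLIntegral_const, mul_comm, ← h, ← lintegral_indicator hJ]
    refine lintegral_congr fun i => ?_
    by_cases hi : i ∈ J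
    · rw [Set.indicator_of_mem hi, Measure.map_apply (hf.measurable_apply i) hS]
      congr 1
      ext x; simp [hi]
    · rw [Set.indicator_of_notMem hi]
      symm
      convert measure_empty (μ := μ)
      ext x; simp [hi]
  filter_upwards [key] with i hi using ⟨hf.measurable_apply i, hi⟩

/-- Zero-one law for subsets of `X` which are invariant under almost every `f_i`. -/
theorem IsRandomTransformation.ae_mem_or_ae_notMem (hf : IsRandomTransformation p μ f) {S : Set X}
    (hS : MeasurableSet S) (h : ∀ᵐ q ∂(p.prod μ), f q.1 q.2 ∈ S ↔ q.2 ∈ S) :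
    (∀ᵐ x ∂μ, x ∈ S) ∨ ∀ᵐ x ∂μ, x ∉ S := by
  have hsnd : MeasurePreserving (Prod.snd : (ℤ → Y) × X → X) (baseMeasure p μ) μ :=
    measurePreserving_snd
  have h' := (measurePreserving_fst_coord p μ 0).quasiMeasurePreserving.ae h
  have key := hf.ergodic.quasiErgodic.ae_mem_or_ae_notMem₀
    (s := Prod.snd ⁻¹' S) (hsnd.measurable hS).nullMeasurableSet
    (by filter_upwards [h'] with q hq using propext hq)
  rw [← hsnd.map_eq]
  rcases key with key | key
  · left; exact (ae_map_iff hsnd.measurable.aemeasurable hS).2 key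
  · right; exact (ae_map_iff hsnd.measurable.aemeasurable hS.compl).2 key

end Base

/-! ### Random walks on a space with an infinite invariant measure -/

theorem measurePreserving_shift_infinitePi {Y : Type*} [MeasurableSpace Y] (p : Measure Y)
    [IsProbabilityMeasure p] (c : ℤ) :
    MeasurePreserving (fun (ω : ℤ → Y) n => ω (n + c))
      (Measure.infinitePi fun _ : ℤ => p) (Measure.infinitePi fun _ : ℤ => p) := by
  refine ⟨measurable_pi_lambda _ fun n => measurable_pi_apply _, ?_⟩
  convert Measure.infinitePi_map_piCongrLeft (fun _ : ℤ => p) (Equiv.subRight c) using 2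
  funext ω n
  obtain ⟨k, rfl⟩ := (Equiv.subRight c).surjective n
  rw [MeasurableEquiv.coe_piCongrLeft, Equiv.piCongrLeft_apply_apply]
  simp

/-- The walk depends only on the coordinates with nonnegative index. -/
theorem snd_iterate_skewShift_congr {Y Z : Type*} (F : Y → Z → Z) (n : ℕ) {ω ω' : ℤ → Y}
    (h : ∀ k : ℤ, 0 ≤ k → ω k = ω' k) (z : Z) :
    ((skewShift F)^[n] (ω, z)).2 = ((skewShift F)^[n] (ω', z)).2 := by
  induction n generalizing ω ω' z with
  | zero => rfl
  | succ n ih =>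
    rw [Function.iterate_succ_apply, Function.iterate_succ_apply]
    simp only [skewShift]
    rw [← h 0 le_rfl]
    exact ih (fun k hk => h _ (by omega)) _

theorem measurable_skewShift {Y Z : Type*} [MeasurableSpace Y] [MeasurableSpace Z] {F : Y → Z → Z}
    (hF : Measurable fun q : Y × Z => F q.1 q.2) :
    Measurable (skewShift F) :=
  (measurable_pi_lambda _ fun _ => (measurable_pi_apply _).comp measurable_fst).prodMk
    (hF.comp (f := fun q : (ℤ → Y) × Z => (q.1 0, q.2))
      (((measurable_pi_apply 0).comp measurable_fst).prodMk measurable_snd))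

section Walk

variable {Y Z : Type*} [MeasurableSpace Y] [MeasurableSpace Z]
  {p : Measure Y} [IsProbabilityMeasure p] {ρ : Measure Z} [SigmaFinite ρ] {F : Y → Z → Z}

/-- The law of the walk after `n + 1` steps, by conditioning on the first step. -/
theorem measure_walk_succ (p : Measure Y) [IsProbabilityMeasure p]
    (hF : Measurable fun q : Y × Z => F q.1 q.2) {S : Set Z} (hS : MeasurableSet S)
    (n : ℕ) (z : Z) :
    (Measure.infinitePi fun _ : ℤ => p) {ω | ((skewShift F)^[n + 1] (ω, z)).2 ∈ S}
      = ∫⁻ i, (Measure.infinitePi fun _ : ℤ => p)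
          {ω | ((skewShift F)^[n] (ω, F i z)).2 ∈ S} ∂p := by
  have hFs := measurable_skewShift hF
  set P := Measure.infinitePi fun _ : ℤ => p
  -- Resample the coordinate `0` of the sequence moved one step to the right.
  have hR := (measurePreserving_update_infinitePi p 0).comp
    ((MeasurePreserving.id p).prod (measurePreserving_shift_infinitePi p (-1)))
  have hm1 : MeasurableSet {ω | ((skewShift F)^[n + 1] (ω, z)).2 ∈ S} :=
    (measurable_snd.comp ((hFs.iterate (n + 1)).comp
      (measurable_id.prodMk measurable_const))) hS
  have hm2 : MeasurableSet {q : Y × (ℤ → Y) | ((skewShift F)^[n] (q.2, F q.1 z)).2 ∈ S} :=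
    (measurable_snd.comp ((hFs.iterate n).comp
      (measurable_snd.prodMk (hF.comp (measurable_fst.prodMk measurable_const))))) hS
  rw [← hR.measure_preimage hm1.nullMeasurableSet]
  refine Eq.trans ?_ (Measure.prod_apply hm2)
  congr 1
  ext ⟨i, ω⟩
  simp only [Set.mem_preimage, Set.mem_ofPred_eq, Function.comp_apply,
    Function.iterate_succ_apply]
  rw [show ((skewShift F)^[n] (skewShift F (Function.update
      (Prod.map id (fun (ω : ℤ → Y) n => ω (n + -1)) (i, ω)).2 0
      (Prod.map id (fun (ω : ℤ → Y) n => ω (n + -1)) (i, ω)).1, z))).2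
      = ((skewShift F)^[n] (ω, F i z)).2 from ?_]
  simp only [skewShift, Prod.map_apply, id, Function.update_self]
  refine snd_iterate_skewShift_congr F n (fun k hk => ?_) _
  rw [Function.update_of_ne (by omega)]
  congr 1; omega

/-- Composition with the second projection embeds `L²(ρ)` into `L²(p × ρ)`; its adjoint is
integration over the first coordinate. -/
theorem adjoint_compMeasurePreserving_snd_ae_eq (k : Lp ℝ 2 (p.prod ρ)) :
    ((Lp.compMeasurePreservingₗᵢ ℝ (E := ℝ) (p := 2) Prod.snd
        (measurePreserving_snd (μ := p) (ν := ρ))).toContinuousLinearMap.adjoint k : Z → ℝ)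
      =ᵐ[ρ] fun z => ∫ i, k (i, z) ∂p := by
  set J₀ := Lp.compMeasurePreservingₗᵢ ℝ (E := ℝ) (p := 2) Prod.snd
        (measurePreserving_snd (μ := p) (ν := ρ))
  have hint : ∀ s, MeasurableSet s → ρ s < ∞ →
      IntegrableOn (k : Y × Z → ℝ) (Prod.snd ⁻¹' s) (p.prod ρ) := fun s hs hs' =>
    integrableOn_Lp_of_measure_ne_top k fact_one_le_two_ennreal.elim
      (by
        rw [(measurePreserving_snd (μ := p) (ν := ρ)).measure_preimage hs.nullMeasurableSet]
        exact hs'.ne)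
  have hint' : ∀ s, MeasurableSet s → ρ s < ∞ →
      Integrable (k : Y × Z → ℝ) (p.prod (ρ.restrict s)) := fun s hs hs' => by
    have := hint s hs hs'
    rwa [IntegrableOn, ← Set.univ_prod, ← Measure.prod_restrict, Measure.restrict_univ] at this
  refine ae_eq_of_forall_setIntegral_eq_of_sigmaFinite (fun s hs hs' => ?_) (fun s hs hs' => ?_)
    fun s hs hs' => ?_
  · exact integrableOn_Lp_of_measure_ne_top _ fact_one_le_two_ennreal.elim hs'.ne
  · exact (hint' s hs hs').integral_prod_right
  · rw [← L2.inner_indicatorConstLp_one (𝕜 := ℝ) hs hs'.ne, ContinuousLinearMap.adjoint_inner_right]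
    have hJ : J₀.toContinuousLinearMap (indicatorConstLp 2 hs hs'.ne (1 : ℝ))
        = indicatorConstLp 2 ((measurePreserving_snd (μ := p) (ν := ρ)).measurable hs)
          (by
        rw [(measurePreserving_snd (μ := p) (ν := ρ)).measure_preimage hs.nullMeasurableSet]
        exact hs'.ne)
          (1 : ℝ) := by
      exact Lp.indicatorConstLp_compMeasurePreserving hs hs'.ne (1 : ℝ) measurePreserving_snd
    rw [hJ, L2.inner_indicatorConstLp_one, ← Set.univ_prod, ← Measure.prod_restrict,
      Measure.restrict_univ, integral_prod_symm _ (hint' s hs hs')]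

variable (hF : MeasurePreserving (fun q : Y × Z => F q.1 q.2) (p.prod ρ) ρ)

/-- The square integrable functions `h` with `h (F_i z) = h z` for almost every `(i, z)`. -/
def invariantL2 : Submodule ℝ (Lp ℝ 2 ρ) :=
  LinearMap.eqLocus (Lp.compMeasurePreservingₗᵢ ℝ (E := ℝ) (p := 2) _ hF).toLinearMap
    (Lp.compMeasurePreservingₗᵢ ℝ (E := ℝ) (p := 2) Prod.snd
      (measurePreserving_snd (μ := p) (ν := ρ))).toLinearMap

theorem mem_invariantL2_iff {h : Lp ℝ 2 ρ} :
    h ∈ invariantL2 hF ↔ ∀ᵐ q ∂(p.prod ρ), h (F q.1 q.2) = h q.2 := by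
  have h1 := Lp.coeFn_compMeasurePreserving h hF
  have h2 := Lp.coeFn_compMeasurePreserving h (measurePreserving_snd (μ := p) (ν := ρ))
  have : h ∈ invariantL2 hF ↔ Lp.compMeasurePreserving _ hF h
      = Lp.compMeasurePreserving Prod.snd (measurePreserving_snd (μ := p) (ν := ρ)) h := Iff.rfl
  rw [this, Lp.ext_iff]
  constructor
  · intro h3
    filter_upwards [h1, h2, h3] with q a b c
    rw [a, b] at c
    exact c
  · intro h3
    filter_upwards [h1, h2, h3] with q a b c
    rw [a, b]
    exact c

/-- The Markov operator `h ↦ ∫ h ∘ F_i dp(i)` on `L²(ρ)`. -/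
def markovL2 : Lp ℝ 2 ρ →L[ℝ] Lp ℝ 2 ρ :=
  (Lp.compMeasurePreservingₗᵢ ℝ (E := ℝ) (p := 2) Prod.snd
    (measurePreserving_snd (μ := p) (ν := ρ))).toContinuousLinearMap.adjoint ∘L
  (Lp.compMeasurePreservingₗᵢ ℝ (E := ℝ) (p := 2) _ hF).toContinuousLinearMap

theorem norm_markovL2_le : ‖markovL2 hF‖ ≤ 1 := by
  refine (ContinuousLinearMap.opNorm_comp_le _ _).trans ?_
  rw [LinearIsometryEquiv.norm_map]
  exact mul_le_one₀ (LinearIsometry.norm_toContinuousLinearMap_le _) (norm_nonneg _)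
    (LinearIsometry.norm_toContinuousLinearMap_le _)

/-- Rigidity of contractions of a Hilbert space: an average of the isometric copies `h ∘ F_i` of
`h` is equal to `h` only if almost all of them are. -/
theorem mem_invariantL2_of_inner_eq {h : Lp ℝ 2 ρ}
    (hh : inner ℝ (Lp.compMeasurePreserving _ hF h)
      (Lp.compMeasurePreserving Prod.snd (measurePreserving_snd (μ := p) (ν := ρ)) h)
        = ‖h‖ ^ 2) : h ∈ invariantL2 hF := by
  have : Lp.compMeasurePreserving _ hF h
      = Lp.compMeasurePreserving Prod.snd (measurePreserving_snd (μ := p) (ν := ρ)) h := by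
    rw [← sub_eq_zero, ← norm_eq_zero, ← sq_eq_zero_iff, norm_sub_sq_real, hh,
      Lp.norm_compMeasurePreserving, Lp.norm_compMeasurePreserving]
    ring
  exact this

/-- Fixed vectors of the Markov operator are invariant functions. -/
theorem mem_invariantL2_of_markovL2_eq {h : Lp ℝ 2 ρ} (hh : markovL2 hF h = h) :
    h ∈ invariantL2 hF := by
  refine mem_invariantL2_of_inner_eq hF ?_
  have h1 : inner ℝ (markovL2 hF h) h = ‖h‖ ^ 2 := by rw [hh, real_inner_self_eq_norm_sq]
  rwa [markovL2, ContinuousLinearMap.comp_apply, ContinuousLinearMap.adjoint_inner_left] at h1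

/-- Powers of the Markov operator on an indicator function give the laws of the walk. -/
theorem iterate_markovL2_indicator_ae_eq {S : Set Z} (hS : MeasurableSet S)
    (hSρ : ρ S ≠ ∞) (n : ℕ) :
    ((markovL2 hF)^[n] (indicatorConstLp 2 hS hSρ (1 : ℝ)) : Z → ℝ) =ᵐ[ρ]
      fun z => (Measure.infinitePi fun _ : ℤ => p).real
        {ω | ((skewShift F)^[n] (ω, z)).2 ∈ S} := by
  induction n with
  | zero =>
    filter_upwards [indicatorConstLp_coeFn (p := 2) (hs := hS) (hμs := hSρ) (c := (1 : ℝ))]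
      with z hz
    simp only [Function.iterate_zero, id]
    rw [hz]
    by_cases h : z ∈ S <;> simp [h]
  | succ n ih =>
    rw [Function.iterate_succ_apply']
    refine (adjoint_compMeasurePreserving_snd_ae_eq _).trans ?_
    have h1 := Lp.coeFn_compMeasurePreserving
      ((markovL2 hF)^[n] (indicatorConstLp 2 hS hSρ (1 : ℝ))) hF
    have h2 := hF.quasiMeasurePreserving.ae ih
    have h3 : ∀ᵐ z ∂ρ, ∀ᵐ i ∂p, Lp.compMeasurePreserving _ hF
        ((markovL2 hF)^[n] (indicatorConstLp 2 hS hSρ (1 : ℝ))) (i, z)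
        = (Measure.infinitePi fun _ : ℤ => p).real
          {ω | ((skewShift F)^[n] (ω, F i z)).2 ∈ S} := by
      have h4 : ∀ᵐ q ∂(p.prod ρ), Lp.compMeasurePreserving _ hF
        ((markovL2 hF)^[n] (indicatorConstLp 2 hS hSρ (1 : ℝ))) q
        = (Measure.infinitePi fun _ : ℤ => p).real
          {ω | ((skewShift F)^[n] (ω, F q.1 q.2)).2 ∈ S} := by
        filter_upwards [h1, h2] with q a b
        rw [a, Function.comp_apply, b]
      exact Measure.ae_ae_of_ae_prod
        ((Measure.measurePreserving_swap (μ := ρ) (ν := p)).quasiMeasurePreserving.ae h4)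
    filter_upwards [h3] with z hz
    refine (integral_congr_ae hz).trans ?_
    have hm2 : MeasurableSet {q : Y × (ℤ → Y) | ((skewShift F)^[n] (q.2, F q.1 z)).2 ∈ S} :=
      (measurable_snd.comp (((measurable_skewShift hF.measurable).iterate n).comp
        (measurable_snd.prodMk (hF.measurable.comp (measurable_fst.prodMk measurable_const))))) hS
    rw [Measure.real, measure_walk_succ p hF.measurable hS]
    exact integral_toReal (measurable_measure_prodMk_left hm2).aemeasurable
      (Eventually.of_forall fun i => measure_lt_top _ _)

/-- If the walk started in a set `V` of finite measure returns to a set `S` of finite measure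
with positive frequency, then by the mean ergodic theorem there is a nonzero invariant function. -/
theorem exists_mem_invariantL2_ne_zero {S V : Set Z} (hS : MeasurableSet S)
    (hSρ : ρ S ≠ ∞) (hV : MeasurableSet V) (hVρ : ρ V ≠ ∞) {c : ℝ} (hc : 0 < c)
    (h : ∀ᶠ N : ℕ in atTop, c * N ≤ ∑ n ∈ Finset.range N,
      ((Measure.infinitePi fun _ : ℤ => p).prod ρ).real
        {q | q.2 ∈ V ∧ ((skewShift F)^[n] q).2 ∈ S}) :
    ∃ k ∈ invariantL2 hF, k ≠ 0 := by
  by_contra! hcon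
  set φ := indicatorConstLp 2 hS hSρ (1 : ℝ)
  set ψ := indicatorConstLp 2 hV hVρ (1 : ℝ)
  have hlim := (markovL2 hF).tendsto_birkhoffAverage_orthogonalProjection (norm_markovL2_le hF) φ
  have h0 : (((markovL2 hF).eqLocus (1 : Lp ℝ 2 ρ →L[ℝ] Lp ℝ 2 ρ)).orthogonalProjectionOnto φ
      : Lp ℝ 2 ρ) = 0 :=
    hcon _ (mem_invariantL2_of_markovL2_eq hF
      (((markovL2 hF).eqLocus (1 : Lp ℝ 2 ρ →L[ℝ] Lp ℝ 2 ρ)).orthogonalProjectionOnto φ).2)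
  rw [h0] at hlim
  have hlim2 := (Filter.Tendsto.inner (𝕜 := ℝ) (tendsto_const_nhds (x := ψ)) hlim)
  rw [inner_zero_right] at hlim2
  have hlow : ∀ᶠ N : ℕ in atTop, c ≤ inner ℝ ψ (birkhoffAverage ℝ (markovL2 hF) _root_.id N φ) := by
    filter_upwards [h, eventually_gt_atTop 0] with N hN hN0
    have hN0' : (0 : ℝ) < N := by exact_mod_cast hN0
    rw [birkhoffAverage, birkhoffSum, inner_smul_right, inner_sum, inv_mul_eq_div,
      le_div_iff₀ hN0']
    refine hN.trans (Finset.sum_le_sum fun n _ => le_of_eq ?_)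
    have hm : MeasurableSet {q : (ℤ → Y) × Z | q.2 ∈ V ∧ ((skewShift F)^[n] q).2 ∈ S} :=
      (measurable_snd hV).inter (measurable_snd.comp
        ((measurable_skewShift hF.measurable).iterate n) hS)
    have hm2 : MeasurableSet {q : (ℤ → Y) × Z | ((skewShift F)^[n] q).2 ∈ S} :=
      (measurable_snd.comp ((measurable_skewShift hF.measurable).iterate n) hS)
    rw [id, L2.inner_indicatorConstLp_one,
      setIntegral_congr_ae hV
        ((iterate_markovL2_indicator_ae_eq hF hS hSρ n).mono fun z hz _ => hz),
      Measure.real, Measure.prod_apply_symm hm]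
    simp only [Measure.real]
    have hm3 : Measurable fun z => (Measure.infinitePi fun _ : ℤ => p)
        {ω | ((skewShift F)^[n] (ω, z)).2 ∈ S} := measurable_measure_prodMk_right hm2
    rw [integral_toReal hm3.aemeasurable (Eventually.of_forall fun i => measure_lt_top _ _),
      ← lintegral_indicator hV]
    congr 1
    refine lintegral_congr fun z => ?_
    by_cases hz : z ∈ V <;> simp [hz]
  exact absurd (ge_of_tendsto hlim2 hlow) (not_le.2 hc)

end Walk

/-! ### Skew products over a random transformation -/

section Skew

variable {Y X K : Type*} [MeasurableSpace Y] [MeasurableSpace X] [Group K] [MeasurableSpace K]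
  [MeasurableMul₂ K]
  {p : Measure Y} [IsProbabilityMeasure p] {μ : Measure X} [IsProbabilityMeasure μ]
  {f : Y → X → X} {A : Y → X → K}

theorem IsRandomCocycle.measurable_skewMap (hA : IsRandomCocycle p μ f A) :
    Measurable fun q : Y × (X × K) => skewMap f A q.1 q.2 := by
  have h : Measurable fun q : Y × (X × K) => (q.1, q.2.1) :=
    measurable_fst.prodMk (measurable_fst.comp measurable_snd)
  exact (hA.base.measurable.comp h).prodMk
    ((hA.measurable.comp h).mul (measurable_snd.comp measurable_snd))

/-- A product measure is invariant under the skew product if the second factor is invariant under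
left translation by the values of the cocycle. -/
theorem IsRandomCocycle.ae_map_skewMap_prod [MeasurableSpace.CountablyGenerated X]
    (hA : IsRandomCocycle p μ f A) {ω : Measure K} [SFinite ω]
    (hω : ∀ i x, ω.map (A i x * ·) = ω) :
    ∀ᵐ i ∂p, (μ.prod ω).map (skewMap f A i) = μ.prod ω := by
  filter_upwards [hA.base.ae_measurePreserving] with i hi
  have h : Measurable fun q : X × K => A i q.1 * q.2 :=
    (hA.measurable.comp (measurable_const.prodMk measurable_fst)).mul measurable_snd
  exact (hi.skew_product (g := fun x u => A i x * u) h (Eventually.of_forall (hω i))).map_eq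

theorem measurePreserving_of_ae_map_eq {Z : Type*} [MeasurableSpace Z] {F : Y → Z → Z}
    {ρ : Measure Z} [SFinite ρ] (hF : Measurable fun q : Y × Z => F q.1 q.2)
    (h : ∀ᵐ i ∂p, ρ.map (F i) = ρ) :
    MeasurePreserving (fun q : Y × Z => F q.1 q.2) (p.prod ρ) ρ := by
  refine ⟨hF, Measure.ext fun S hS => ?_⟩
  rw [Measure.map_apply hF hS, Measure.prod_apply (hF hS)]
  have : ∀ᵐ i ∂p, ρ (Prod.mk i ⁻¹' ((fun q : Y × Z => F q.1 q.2) ⁻¹' S)) = ρ S := by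
    filter_upwards [h] with i hi
    have hFi : Measurable (F i) := hF.comp measurable_prodMk_left
    conv_rhs => rw [← hi, Measure.map_apply hFi hS]
    rfl
  rw [lintegral_congr_ae this]
  simp

theorem IsInvariant.isStationary {Z : Type*} [SMul K Z] [MeasurableSpace Z]
    {π : Measure (X × Z)} (h : IsInvariant p μ f A π) : IsStationary p μ f A π := by
  refine ⟨h.proj, fun S _ => ?_⟩
  rw [lintegral_congr_ae (h.invariant.mono fun i hi => by rw [hi])]
  simp

theorem IsStationary.measurePreserving (hA : IsRandomCocycle p μ f A) {π : Measure (X × K)}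
    [SFinite π] (h : IsStationary p μ f A π) :
    MeasurePreserving (fun q : Y × (X × K) => skewMap f A q.1 q.2) (p.prod π) π := by
  have hF := hA.measurable_skewMap
  refine ⟨hF, Measure.ext fun S hS => ?_⟩
  rw [Measure.map_apply hF hS, Measure.prod_apply (hF hS), ← h.stationary S hS]
  refine lintegral_congr fun i => ?_
  have hFi : Measurable (skewMap f A i) := hF.comp (measurable_prodMk_left (x := i))
  rw [Measure.map_apply hFi hS]
  rfl

theorem IsStationary.of_map_eq (hA : IsRandomCocycle p μ f A) {π : Measure (X × K)}
    [SFinite π] (hproj : π.map Prod.fst = μ)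
    (h : (p.prod π).map (fun q : Y × (X × K) => skewMap f A q.1 q.2) = π) :
    IsStationary p μ f A π := by
  have hF := hA.measurable_skewMap
  refine ⟨hproj, fun S hS => ?_⟩
  conv_rhs => rw [← h, Measure.map_apply hF hS, Measure.prod_apply (hF hS)]
  refine lintegral_congr fun i => ?_
  have hFi : Measurable (skewMap f A i) := hF.comp (measurable_prodMk_left (x := i))
  rw [Measure.map_apply hFi hS]
  rfl

end Skew

theorem iterate_skewShift_skewMap {Y X G : Type*} [Group G] (f : Y → X → X)
    (A : Y → X → G) (n : ℕ) (ω : ℤ → Y) (x : X) (g : G) :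
    (skewShift (skewMap f A))^[n] (ω, (x, g)) =
      (((skewShift f)^[n] (ω, x)).1, (((skewShift f)^[n] (ω, x)).2,
        iter (skewShift f) (generator A) n (ω, x) * g)) := by
  induction n with
  | zero => simp [iter]
  | succ n ih =>
    rw [Function.iterate_succ_apply', ih, Function.iterate_succ_apply']
    simp only [skewShift, skewMap, iter, generator, smul_eq_mul, mul_assoc]

section Existence

variable {Y X G : Type*} [MeasurableSpace Y] [MeasurableSpace X]
  [Group G] [TopologicalSpace G] [IsTopologicalGroup G] [LocallyCompactSpace G] [T2Space G]
  [SecondCountableTopology G] [MeasurableSpace G] [BorelSpace G]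
  {p : Measure Y} [IsProbabilityMeasure p] {μ : Measure X} [IsProbabilityMeasure μ]
  {f : Y → X → X} {A : Y → X → G}

theorem IsRandomCocycle.measurable_iter (hA : IsRandomCocycle p μ f A) (n : ℕ) :
    Measurable (iter (skewShift f) (generator A) n) := by
  have hg : Measurable (generator A) := hA.measurable.comp
    (f := fun q : (ℤ → Y) × X => (q.1 0, q.2))
    (((measurable_pi_apply 0).comp measurable_fst).prodMk measurable_snd)
  induction n with
  | zero => exact measurable_const
  | succ n ih => exact (hg.comp (hA.base.measurable_skewShift.iterate n)).mul ih

/-- An essentially bounded cocycle returns to a compact set with positive frequency. -/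
theorem EssentiallyBounded.eventually_le_sum (hA : IsRandomCocycle p μ f A)
    (hb : EssentiallyBounded p μ f A) :
    ∃ K : Set G, IsCompact K ∧ ∃ c : ℝ, 0 < c ∧ ∀ᶠ N : ℕ in atTop, c * N ≤
      ∑ n ∈ Finset.range N, (baseMeasure p μ).real
        {q | iter (skewShift f) (generator A) n q ∈ K} := by
  obtain ⟨K, hK, δ, hδ, E, -, hEpos, hE⟩ := hb
  have : IsProbabilityMeasure (baseMeasure p μ) := by unfold baseMeasure; infer_instance
  set D : (ℤ → Y) × X → Set ℕ := fun q => {n | iter (skewShift f) (generator A) n q ∈ K} with hD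
  set EN : ℕ → Set ((ℤ → Y) × X) := fun N =>
    {q | ∀ n ≥ N, δ / 2 < ((Set.Icc 0 n ∩ D q).ncard : ℝ) / n} with hEN
  have hcover : E ⊆ ⋃ N, EN N := by
    intro q hq
    have h1 : δ / 2 < lowerDensity (D q) := lt_of_lt_of_le (half_lt_self hδ) (hE q hq)
    have h2 := eventually_lt_of_lt_liminf h1
      (isBoundedUnder_of_eventually_ge (a := 0) (Eventually.of_forall fun n => by positivity))
    obtain ⟨N, hN⟩ := eventually_atTop.1 h2
    exact Set.mem_iUnion.2 ⟨N, hN⟩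
  obtain ⟨N₀, hN₀⟩ : ∃ N, 0 < baseMeasure p μ (EN N) := by
    by_contra! h
    refine hEpos.ne' (measure_mono_null hcover (measure_iUnion_null fun N => ?_))
    exact le_antisymm (h N) bot_le
  have hpos : 0 < (baseMeasure p μ).real (EN N₀) :=
    ENNReal.toReal_pos hN₀.ne' (measure_ne_top _ _)
  have hmeas : ∀ n, MeasurableSet {q | iter (skewShift f) (generator A) n q ∈ K} := fun n =>
    hA.measurable_iter n hK.isClosed.measurableSet
  -- One factor `1 / 2` comes from `EN`, another from `n / (n + 1) ≥ 1 / 2`, where `N = n + 1`.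
  refine ⟨K, hK, δ / 4 * (baseMeasure p μ).real (EN N₀), by positivity, ?_⟩
  filter_upwards [eventually_ge_atTop (N₀ + 2)] with N hN
  obtain ⟨n, rfl⟩ : ∃ n, N = n + 1 := ⟨N - 1, by omega⟩
  have hn0 : (1 : ℝ) ≤ n := by exact_mod_cast (by omega : 1 ≤ n)
  set S : (ℤ → Y) × X → ℝ := fun q => ∑ k ∈ Finset.range (n + 1),
    Set.indicator {q | iter (skewShift f) (generator A) k q ∈ K} (fun _ => (1 : ℝ)) q with hS
  have hcard : ∀ q, ((Set.Icc 0 n ∩ D q).ncard : ℝ) = S q := by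
    intro q
    classical
    have : Set.Icc 0 n ∩ D q = ((Finset.range (n + 1)).filter (· ∈ D q) : Finset ℕ) := by
      ext k; simp
    rw [this, Set.ncard_coe_finset, hS, Finset.card_filter]
    push_cast
    refine Finset.sum_congr rfl fun k _ => ?_
    simp [Set.indicator_apply, hD]
  have hint : ∀ k ∈ Finset.range (n + 1), Integrable (Set.indicator
      {q | iter (skewShift f) (generator A) k q ∈ K} (fun _ => (1 : ℝ))) (baseMeasure p μ) :=
    fun k _ => (integrable_const 1).indicator (hmeas k)
  have hSint : ∫ q, S q ∂(baseMeasure p μ) = ∑ k ∈ Finset.range (n + 1), (baseMeasure p μ).real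
        {q | iter (skewShift f) (generator A) k q ∈ K} := by
    rw [hS, integral_finsetSum _ hint]
    exact Finset.sum_congr rfl fun k _ => by rw [integral_indicator_const _ (hmeas k)]; simp
  rw [← hSint]
  have hS0 : ∀ q, 0 ≤ S q := fun q => Finset.sum_nonneg fun k _ =>
    Set.indicator_nonneg (fun _ _ => zero_le_one) _
  -- Markov's inequality on the set where the frequency of visits is at least `δ / 2`.
  have hmarkov := mul_meas_ge_le_integral_of_nonneg (Eventually.of_forall hS0)
    (integrable_finsetSum _ hint) (δ / 2 * n)
  have hsub : EN N₀ ⊆ {q | δ / 2 * n ≤ S q} := by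
    intro q hq
    have := hq n (by omega)
    rw [lt_div_iff₀ (by linarith), hcard] at this
    exact this.le
  have hle : (baseMeasure p μ).real (EN N₀) ≤ (baseMeasure p μ).real {q | δ / 2 * n ≤ S q} :=
    measureReal_mono hsub
  refine le_trans ?_ hmarkov
  calc δ / 4 * (baseMeasure p μ).real (EN N₀) * ((n + 1 : ℕ) : ℝ)
      = δ / 4 * ((n : ℝ) + 1) * (baseMeasure p μ).real (EN N₀) := by push_cast; ring
    _ ≤ δ / 2 * n * (baseMeasure p μ).real (EN N₀) := by
        gcongr ?_ * _
        nlinarith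
    _ ≤ _ := by gcongr

variable [MeasurableSpace.CountablyGenerated X]

theorem IsRandomCocycle.measurePreserving_haar (hA : IsRandomCocycle p μ f A) :
    MeasurePreserving (fun q : Y × (X × G) => skewMap f A q.1 q.2)
      (p.prod (μ.prod (Measure.haar : Measure G))) (μ.prod Measure.haar) :=
  measurePreserving_of_ae_map_eq hA.measurable_skewMap
    (hA.ae_map_skewMap_prod fun _ _ => map_mul_left_eq_self _ _)

/-- An essentially bounded cocycle admits a nonzero square integrable invariant function on the
skew product with Haar measure. -/
theorem EssentiallyBounded.exists_mem_invariantL2_ne_zero (hA : IsRandomCocycle p μ f A)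
    (hb : EssentiallyBounded p μ f A) :
    ∃ k ∈ invariantL2 hA.measurePreserving_haar, k ≠ 0 := by
  obtain ⟨K, hK, c, hc, hsum⟩ := hb.eventually_le_sum hA
  obtain ⟨V, hV, hV1⟩ := exists_compact_mem_nhds (1 : G)
  have hVpos : 0 < (Measure.haar : Measure G).real V :=
    ENNReal.toReal_pos (Measure.measure_pos_of_mem_nhds _ hV1).ne' hV.measure_ne_top
  -- A walk started at `u ∈ V` is in `K * V` at the times `n` with `A^n ∈ K`.
  have hKV : IsCompact (K * V) := hK.mul hV
  have hfin : ∀ {C : Set G}, IsCompact C →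
      (μ.prod (Measure.haar : Measure G)) (Set.univ ×ˢ C) ≠ ∞ := fun {C} hC => by
    rw [Measure.prod_prod, measure_univ, one_mul]; exact hC.measure_ne_top
  refine RandomCocycle.exists_mem_invariantL2_ne_zero hA.measurePreserving_haar
    (S := Set.univ ×ˢ (K * V)) (V := Set.univ ×ˢ V)
    (MeasurableSet.univ.prod hKV.isClosed.measurableSet) (hfin hKV)
    (MeasurableSet.univ.prod hV.isClosed.measurableSet) (hfin hV)
    (c := c * (Measure.haar : Measure G).real V) (by positivity) ?_
  filter_upwards [hsum] with N hN
  calc c * (Measure.haar : Measure G).real V * N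
      = (c * N) * (Measure.haar : Measure G).real V := by ring
    _ ≤ (∑ n ∈ Finset.range N, (baseMeasure p μ).real
        {q | iter (skewShift f) (generator A) n q ∈ K}) * (Measure.haar : Measure G).real V := by
        gcongr
    _ ≤ _ := ?_
  rw [Finset.sum_mul]
  refine Finset.sum_le_sum fun n _ => ?_
  have hassoc := (measurePreserving_prodAssoc (Measure.infinitePi fun _ : ℤ => p) μ
    (Measure.haar : Measure G))
  have hm1 : MeasurableSet ({q : (ℤ → Y) × X | iter (skewShift f) (generator A) n q ∈ K} ×ˢ V) :=
    (hA.measurable_iter n hK.isClosed.measurableSet).prod hV.isClosed.measurableSet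
  have hF := measurable_skewShift hA.measurable_skewMap
  have hm2 : MeasurableSet {q : (ℤ → Y) × (X × G) | q.2 ∈ Set.univ ×ˢ V ∧
      ((skewShift (skewMap f A))^[n] q).2 ∈ Set.univ ×ˢ (K * V)} :=
    (measurable_snd (MeasurableSet.univ.prod hV.isClosed.measurableSet)).inter
      ((measurable_snd.comp (hF.iterate n)) (MeasurableSet.univ.prod hKV.isClosed.measurableSet))
  rw [baseMeasure, ← measureReal_prod_prod, Measure.real, Measure.real,
    ← hassoc.measure_preimage hm2.nullMeasurableSet]
  refine ENNReal.toReal_mono ?_ (measure_mono ?_)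
  · rw [hassoc.measure_preimage hm2.nullMeasurableSet]
    refine ne_top_of_le_ne_top ?_ (measure_mono (t := Set.univ ×ˢ (Set.univ ×ˢ V)) ?_)
    · rw [Measure.prod_prod, measure_univ, one_mul]
      exact hfin hV
    · rintro ⟨ω, x, g⟩ ⟨h1, -⟩
      exact ⟨trivial, h1⟩
  · rintro ⟨⟨ω, x⟩, g⟩ ⟨h1, h2⟩
    refine ⟨⟨trivial, h2⟩, ?_⟩
    change ((skewShift (skewMap f A))^[n] (ω, (x, g))).2 ∈ _
    rw [iterate_skewShift_skewMap]
    exact ⟨trivial, Set.mul_mem_mul h1 h2⟩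

end Existence

/-! ### Measurable selections -/

theorem exists_seq_isCompact_basis (G : Type*) [TopologicalSpace G] [T2Space G]
    [LocallyCompactSpace G] [SecondCountableTopology G] [Nonempty G] :
    ∃ K : ℕ → Set G, (∀ n, IsCompact (K n)) ∧
      ∀ U : Set G, IsOpen U → ∀ g ∈ U, ∃ n, g ∈ K n ∧ K n ⊆ U := by
  set B : Set (Set G) := {L | IsCompact L ∧ ∃ b ∈ TopologicalSpace.countableBasis G, closure b = L}
  have hBc : B.Countable :=
    ((TopologicalSpace.countable_countableBasis G).image closure).mono
      fun L hL => hL.2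
  have hB : ∀ U : Set G, IsOpen U → ∀ g ∈ U, ∃ L ∈ B, g ∈ L ∧ L ⊆ U := by
    intro U hU g hg
    obtain ⟨N, hN, hNU, hNc⟩ := local_compact_nhds (hU.mem_nhds hg)
    obtain ⟨b, hb, hgb, hbN⟩ :=
      (TopologicalSpace.isBasis_countableBasis G).exists_subset_of_mem_open
      (mem_interior_iff_mem_nhds.2 hN) isOpen_interior
    have hcl : closure b ⊆ N := closure_minimal (hbN.trans interior_subset) hNc.isClosed
    exact ⟨closure b, ⟨hNc.of_isClosed_subset isClosed_closure hcl, b, hb, rfl⟩,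
      subset_closure hgb, hcl.trans hNU⟩
  have hne : B.Nonempty := by
    obtain ⟨L, hL, -⟩ := hB Set.univ isOpen_univ (Classical.arbitrary G) trivial
    exact ⟨L, hL⟩
  obtain ⟨K, hK⟩ := hBc.exists_eq_range hne
  refine ⟨K, fun n => ?_, fun U hU g hg => ?_⟩
  · have : K n ∈ B := hK ▸ Set.mem_range_self n
    exact this.1
  · obtain ⟨L, hL, h⟩ := hB U hU g hg
    rw [hK] at hL
    obtain ⟨n, rfl⟩ := hL
    exact ⟨n, h⟩

/-- A closed-valued map into a locally compact, second countable space which meets each compact set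
in a measurable set of points has a measurable selection.

Run through a sequence `K n` of compact sets containing arbitrarily small neighbourhoods of each
point, and cut down `C a` by `K n` whenever this leaves a nonempty set. If `s a` lies in what
remains, then `s a ∈ K n` holds exactly when the `n`-th cut was made, which is a measurable
condition on `a`. -/
theorem exists_measurable_selection {α G : Type*} [MeasurableSpace α] [TopologicalSpace G]
    [T2Space G] [LocallyCompactSpace G] [SecondCountableTopology G] [MeasurableSpace G]
    [BorelSpace G] [Nonempty G] (C : α → Set G) (hC : ∀ a, IsClosed (C a))
    (hm : ∀ L : Set G, IsCompact L → MeasurableSet {a | (C a ∩ L).Nonempty}) :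
    ∃ s : α → G, Measurable s ∧ ∀ a, (C a).Nonempty → s a ∈ C a := by
  classical
  obtain ⟨K, hK, hKb⟩ := exists_seq_isCompact_basis G
  let D : ℕ → α → Set G := fun n => Nat.rec (motive := fun _ => α → Set G) (fun _ => Set.univ)
    (fun n Dn a => if (C a ∩ Dn a ∩ K n).Nonempty then Dn a ∩ K n else Dn a) n
  have hD0 : ∀ a, D 0 a = Set.univ := fun a => rfl
  have hDs : ∀ n a, D (n + 1) a =
      if (C a ∩ D n a ∩ K n).Nonempty then D n a ∩ K n else D n a := fun n a => rfl
  have hDclosed : ∀ n a, IsClosed (D n a) := by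
    intro n a
    induction n with
    | zero => exact isClosed_univ
    | succ n ih =>
      rw [hDs]
      split_ifs
      · exact ih.inter (hK n).isClosed
      · exact ih
  have hDanti : ∀ n a, D (n + 1) a ⊆ D n a := by
    intro n a
    rw [hDs]
    split_ifs
    · exact Set.inter_subset_left
    · exact subset_rfl
  have hDne : ∀ a, (C a).Nonempty → ∀ n, (C a ∩ D n a).Nonempty := by
    intro a ha n
    induction n with
    | zero => simpa [hD0] using ha
    | succ n ih =>
      rw [hDs]
      split_ifs with h
      · rwa [← Set.inter_assoc]
      · exact ih
  have hDm : ∀ n, ∀ L : Set G, IsCompact L → MeasurableSet {a | (C a ∩ D n a ∩ L).Nonempty} := by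
    intro n
    induction n with
    | zero => intro L hL; simpa [hD0] using hm L hL
    | succ n ih =>
      intro L hL
      have : {a | (C a ∩ D (n + 1) a ∩ L).Nonempty} =
          ({a | (C a ∩ D n a ∩ K n).Nonempty} ∩ {a | (C a ∩ D n a ∩ (K n ∩ L)).Nonempty}) ∪
          ({a | (C a ∩ D n a ∩ K n).Nonempty}ᶜ ∩ {a | (C a ∩ D n a ∩ L).Nonempty}) := by
        ext a
        simp only [Set.mem_ofPred_eq, Set.mem_union, Set.mem_inter_iff, Set.mem_compl_iff, hDs]
        by_cases h : (C a ∩ D n a ∩ K n).Nonempty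
        · simp only [h, if_true, true_and, not_true, false_and, or_false]
          simp only [Set.inter_assoc]
        · simp [h]
      rw [this]
      exact ((ih _ (hK n)).inter (ih _ ((hK n).inter_right hL.isClosed))).union
        ((ih _ (hK n)).compl.inter (ih _ hL))
  have hex : ∀ a, (C a).Nonempty → ∃ g ∈ C a, ∀ n, g ∈ D n a := by
    intro a ha
    obtain ⟨n, hn⟩ : ∃ n, (C a ∩ D n a ∩ K n).Nonempty := by
      by_contra! h
      have huniv : ∀ n, D n a = Set.univ := by
        intro n
        induction n with
        | zero => rfl
        | succ n ih => rw [hDs, h n]; simpa using ih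
      obtain ⟨g, hg⟩ := ha
      obtain ⟨n, hgn, -⟩ := hKb Set.univ isOpen_univ g trivial
      have := h n
      rw [huniv, Set.inter_univ] at this
      exact (this ▸ ⟨hg, hgn⟩ : g ∈ (∅ : Set G))
    have hcomp : IsCompact (C a ∩ D (n + 1 + 0) a) := by
      rw [add_zero, hDs, if_pos hn]
      exact (hK n).of_isClosed_subset
        ((hC a).inter ((hDclosed n a).inter (hK n).isClosed)) fun g hg => hg.2.2
    obtain ⟨g, hg⟩ := IsCompact.nonempty_iInter_of_sequence_nonempty_isCompact_isClosed
      (fun k => C a ∩ D (n + 1 + k) a)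
      (fun k => Set.inter_subset_inter_right _ (hDanti (n + 1 + k) a)) (fun k => hDne a ha _) hcomp
      (fun k => (hC a).inter (hDclosed _ a))
    rw [Set.mem_iInter] at hg
    have hanti : Antitone fun k => D k a := antitone_nat_of_succ_le fun k => hDanti k a
    exact ⟨g, (hg 0).1, fun k => hanti (by omega : k ≤ n + 1 + k) (hg k).2⟩
  choose! s hsC hsD using hex
  let t : α → G := fun a => if (C a).Nonempty then s a else Classical.arbitrary G
  have hKiff : ∀ a, (C a).Nonempty → ∀ n, (s a ∈ K n ↔ (C a ∩ D n a ∩ K n).Nonempty) := by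
    intro a ha n
    refine ⟨fun h => ⟨s a, ⟨hsC a ha, hsD a ha n⟩, h⟩, fun h => ?_⟩
    have := hsD a ha (n + 1)
    rw [hDs, if_pos h] at this
    exact this.2
  have hCm : MeasurableSet {a | (C a).Nonempty} := by
    have : {a | (C a).Nonempty} = ⋃ n, {a | (C a ∩ K n).Nonempty} := by
      ext a
      simp only [Set.mem_ofPred_eq, Set.mem_iUnion]
      constructor
      · rintro ⟨g, hg⟩
        obtain ⟨n, hn, -⟩ := hKb Set.univ isOpen_univ g trivial
        exact ⟨n, g, hg, hn⟩
      · rintro ⟨n, g, hg, -⟩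
        exact ⟨g, hg⟩
    rw [this]
    exact MeasurableSet.iUnion fun n => hm _ (hK n)
  refine ⟨t, measurable_of_isOpen fun U hU => ?_, fun a ha => by simp [t, ha, hsC a ha]⟩
  have : t ⁻¹' U = (⋃ n ∈ {n | K n ⊆ U}, {a | (C a ∩ D n a ∩ K n).Nonempty}) ∪
      ({a | (C a).Nonempty}ᶜ ∩ {_a | Classical.arbitrary G ∈ U}) := by
    ext a
    simp only [Set.mem_preimage, Set.mem_union, Set.mem_iUnion, Set.mem_inter_iff,
      Set.mem_compl_iff, Set.mem_ofPred_eq, t, exists_prop]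
    by_cases ha : (C a).Nonempty
    · simp only [ha, if_true, not_true, false_and, or_false]
      constructor
      · intro h
        obtain ⟨n, h1, h2⟩ := hKb U hU _ h
        exact ⟨n, h2, (hKiff a ha n).1 h1⟩
      · rintro ⟨n, h2, h1⟩
        exact h2 ((hKiff a ha n).2 h1)
    · rw [Set.not_nonempty_iff_eq_empty] at ha
      simp [ha]
  rw [this]
  exact (MeasurableSet.iUnion fun n => MeasurableSet.iUnion fun _ => hDm n _ (hK n)).union
    (hCm.compl.inter (MeasurableSet.const _))

/-! ### Equivariant maps into a proper action -/

section Orbit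

variable {Y X G E : Type*} [MeasurableSpace Y] [MeasurableSpace X]
  [Group G] [TopologicalSpace G] [IsTopologicalGroup G] [LocallyCompactSpace G] [T2Space G]
  [SecondCountableTopology G] [MeasurableSpace G] [BorelSpace G]
  [TopologicalSpace E] [T2Space E] [SecondCountableTopology E] [MeasurableSpace E] [BorelSpace E]
  {p : Measure Y} [IsProbabilityMeasure p] {μ : Measure X} [IsProbabilityMeasure μ]
  {f : Y → X → X} {A : Y → X → G}

/-- Let `R` be a continuous right action of `G` on `E`, proper near the points of `E₀`, and `Φ` an
equivariant map from `X` to `E` that takes values in `E₀` with positive probability. Then almost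
all values of `Φ` lie on the orbit of one point `v₀ ∈ E₀`, and they can be moved to `v₀` by group
elements depending measurably on `x`.

Here `v₀` is a point of the support of the law of `Φ`: by ergodicity, the orbit of almost every
`Φ x` meets each neighbourhood of `v₀`, and by properness it contains `v₀`. -/
theorem IsRandomTransformation.exists_measurable_orbit_map (hf : IsRandomTransformation p μ f)
    (R : G → E → E) (hR : Continuous fun q : G × E => R q.1 q.2) (hR1 : ∀ v, R 1 v = v)
    (hRmul : ∀ a b v, R (a * b) v = R b (R a v)) {Φ : X → E} (hΦ : Measurable Φ)
    (hequi : ∀ᵐ q ∂(p.prod μ), R (A q.1 q.2) (Φ (f q.1 q.2)) = Φ q.2) {E₀ : Set E}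
    (hproper : ∀ v ∈ E₀, ∀ w, ∃ U ∈ 𝓝 v, ∃ L : Set G, IsCompact L ∧ ∀ g, R g w ∈ U → g ∈ L)
    (hpos : μ.map Φ E₀ ≠ 0) :
    ∃ v₀ ∈ E₀, ∃ P : X → G, Measurable P ∧ ∀ᵐ x ∂μ, R (P x) (Φ x) = v₀ := by
  obtain ⟨v₀, hv₀, hsupp⟩ := exists_mem_forall_mem_nhdsWithin_pos_measure hpos
  refine ⟨v₀, hv₀, ?_⟩
  have hRg : ∀ g, Continuous (R g) := fun g => hR.comp (continuous_const.prodMk continuous_id)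
  have hRv : ∀ v, Continuous fun g => R g v := fun v =>
    hR.comp (continuous_id.prodMk continuous_const)
  have hvisit : ∀ U : Set E, IsOpen U → v₀ ∈ U → ∀ᵐ x ∂μ, ∃ g, R g (Φ x) ∈ U := by
    intro U hU hvU
    have hopen : IsOpen {w | ∃ g, R g w ∈ U} := by
      have : {w | ∃ g, R g w ∈ U} = ⋃ g, R g ⁻¹' U := by ext; simp
      rw [this]
      exact isOpen_iUnion fun g => hU.preimage (hRg g)
    have hS : MeasurableSet (Φ ⁻¹' {w | ∃ g, R g w ∈ U}) := hΦ hopen.measurableSet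
    have hinv : ∀ᵐ q ∂(p.prod μ), f q.1 q.2 ∈ Φ ⁻¹' {w | ∃ g, R g w ∈ U} ↔
        q.2 ∈ Φ ⁻¹' {w | ∃ g, R g w ∈ U} := by
      filter_upwards [hequi] with q hq
      constructor
      · rintro ⟨g, hg⟩
        refine ⟨(A q.1 q.2)⁻¹ * g, ?_⟩
        rw [← hq, ← hRmul, mul_inv_cancel_left]
        exact hg
      · rintro ⟨g, hg⟩
        refine ⟨A q.1 q.2 * g, ?_⟩
        rw [hRmul, hq]
        exact hg
    rcases hf.ae_mem_or_ae_notMem hS hinv with h | h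
    · exact h
    · exfalso
      have h1 : 0 < μ.map Φ U := hsupp U (mem_nhdsWithin_of_mem_nhds (hU.mem_nhds hvU))
      rw [Measure.map_apply hΦ hU.measurableSet] at h1
      refine h1.ne' (measure_mono_null (t := Φ ⁻¹' {w | ∃ g, R g w ∈ U}) (fun x hx => ?_) ?_)
      · exact ⟨1, by rw [hR1]; exact hx⟩
      · simpa [ae_iff] using h
  have hall : ∀ᵐ x ∂μ, ∃ g, R g (Φ x) = v₀ := by
    have hb : ∀ᵐ x ∂μ, ∀ b ∈ TopologicalSpace.countableBasis E, v₀ ∈ b → ∃ g, R g (Φ x) ∈ b := by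
      refine (ae_ball_iff (TopologicalSpace.countable_countableBasis E)).2 fun b hb => ?_
      by_cases hv : v₀ ∈ b
      · filter_upwards [hvisit b (TopologicalSpace.isOpen_of_mem_countableBasis hb) hv] with x hx _
          using hx
      · exact Eventually.of_forall fun x h => absurd h hv
    filter_upwards [hb] with x hx
    obtain ⟨U, hU, L, hL, hUL⟩ := hproper v₀ hv₀ (Φ x)
    have himg : IsCompact ((fun g => R g (Φ x)) '' L) := hL.image (hRv _)
    have hmem : v₀ ∈ closure ((fun g => R g (Φ x)) '' L) := by
      rw [mem_closure_iff_nhds]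
      intro N hN
      obtain ⟨b, hb, hvb, hbN⟩ :=
        (TopologicalSpace.isBasis_countableBasis E).mem_nhds_iff.1 (inter_mem hN hU)
      obtain ⟨g, hg⟩ := hx b hb hvb
      exact ⟨R g (Φ x), (hbN hg).1, g, hUL g (hbN hg).2, rfl⟩
    rw [himg.isClosed.closure_eq] at hmem
    obtain ⟨g, -, hg⟩ := hmem
    exact ⟨g, hg⟩
  obtain ⟨P, hP, hPx⟩ := exists_measurable_selection (fun x => {g | R g (Φ x) = v₀})
    (fun x => isClosed_eq (hRv _) continuous_const) fun L hL => by
      have himg : IsCompact ((fun g : G => R g⁻¹ v₀) '' L) :=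
        hL.image ((hRv v₀).comp continuous_inv)
      have : {x | ({g | R g (Φ x) = v₀} ∩ L).Nonempty} = Φ ⁻¹' ((fun g : G => R g⁻¹ v₀) '' L) := by
        ext x
        simp only [Set.mem_ofPred_eq, Set.mem_preimage, Set.mem_image]
        constructor
        · rintro ⟨g, hg, hgL⟩
          refine ⟨g, hgL, ?_⟩
          rw [← (hg : R g (Φ x) = v₀), ← hRmul, mul_inv_cancel, hR1]
        · rintro ⟨g, hgL, hg⟩
          refine ⟨g, ?_, hgL⟩
          change R g (Φ x) = v₀
          rw [← hg, ← hRmul, inv_mul_cancel, hR1]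
      rw [this]
      exact hΦ himg.isClosed.measurableSet
  refine ⟨P, hP, ?_⟩
  filter_upwards [hall] with x hx using hPx x hx

end Orbit

/-! ### The regular representation -/

section Regular

variable {G : Type*} [Group G] [TopologicalSpace G] [IsTopologicalGroup G] [LocallyCompactSpace G]
  [T2Space G] [SecondCountableTopology G] [MeasurableSpace G] [BorelSpace G]

/-- Translates of an element of `L²(G)` by group elements outside a compact set stay away from a
nonzero vector: up to a small error both have compact support, and disjoint supports. -/
theorem exists_isCompact_of_norm_smul_sub_lt (v w : Lp ℝ 2 (Measure.haar : Measure G))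
    (hv : v ≠ 0) :
    ∃ L : Set G, IsCompact L ∧ ∀ g : G, ‖DomMulAct.mk g • w - v‖ < ‖v‖ / 2 → g ∈ L := by
  have hv0 : 0 < ‖v‖ := norm_pos_iff.2 hv
  have happrox : ∀ u : Lp ℝ 2 (Measure.haar : Measure G), ∃ u' : G → ℝ, HasCompactSupport u' ∧
      ∃ hu' : MemLp u' 2 Measure.haar, ‖u - hu'.toLp u'‖ ≤ ‖v‖ / 8 := by
    intro u
    obtain ⟨u', hc, hle, -, hu'⟩ := (Lp.memLp u).exists_hasCompactSupport_eLpNorm_sub_le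
      (by norm_num) (ε := ENNReal.ofReal (‖v‖ / 8)) (by simpa using hv0)
    refine ⟨u', hc, hu', ?_⟩
    rw [Lp.norm_def]
    refine ENNReal.toReal_le_of_le_ofReal (by positivity) (le_trans (le_of_eq ?_) hle)
    refine eLpNorm_congr_ae ?_
    filter_upwards [Lp.coeFn_sub u (hu'.toLp u'), hu'.coeFn_toLp] with x h1 h2
    rw [h1, Pi.sub_apply, Pi.sub_apply, h2]
  obtain ⟨v', hvc, hv', hvle⟩ := happrox v
  obtain ⟨w', hwc, hw', hwle⟩ := happrox w
  refine ⟨tsupport w' * (tsupport v')⁻¹, hwc.isCompact.mul hvc.isCompact.inv, fun g hg => ?_⟩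
  by_contra hgL
  have hdisj : ∀ u, v' u ≠ 0 → w' (g * u) = 0 := by
    intro u hu
    by_contra hw0
    refine hgL ⟨g * u, subset_tsupport _ hw0, u⁻¹, ?_, by group⟩
    rw [Set.inv_mem_inv]
    exact subset_tsupport _ hu
  set W := hw'.toLp w'
  set V := hv'.toLp v'
  have h1 : ‖V‖ ≤ ‖DomMulAct.mk g • W - V‖ := by
    refine Lp.norm_le_norm_of_ae_le ?_
    have hW : ∀ᵐ u ∂(Measure.haar : Measure G), (DomMulAct.mk g • W) u = w' (g * u) :=
      (hw'.comp_measurePreserving (measurePreserving_smul g _)).coeFn_toLp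
    have hV : ∀ᵐ u ∂(Measure.haar : Measure G), V u = v' u := hv'.coeFn_toLp
    filter_upwards [Lp.coeFn_sub (DomMulAct.mk g • W) V, hV, hW] with u a b c
    rw [a, Pi.sub_apply, b, c]
    by_cases hu : v' u = 0
    · simp [hu]
    · simp [hdisj u hu]
  have h2 : ‖DomMulAct.mk g • W - V‖
      ≤ ‖DomMulAct.mk g • W - DomMulAct.mk g • w‖ + ‖DomMulAct.mk g • w - v‖ + ‖v - V‖ := by
    have := norm_add₃_le (a := DomMulAct.mk g • W - DomMulAct.mk g • w)
      (b := DomMulAct.mk g • w - v) (c := v - V)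
    simpa using this
  have h3 : ‖DomMulAct.mk g • W - DomMulAct.mk g • w‖ ≤ ‖v‖ / 8 := by
    rw [← DomMulAct.smul_Lp_sub, DomMulAct.norm_smul_Lp, norm_sub_rev]
    exact hwle
  have h4 : ‖v‖ ≤ ‖v - V‖ + ‖V‖ := by simpa using norm_add_le (v - V) V
  linarith

end Regular

/-! ### Currying square integrable functions -/

theorem measurable_of_measurable_edist {α E : Type*} [MeasurableSpace α] [PseudoEMetricSpace E]
    [SecondCountableTopology E] [MeasurableSpace E] [BorelSpace E] {Φ : α → E}
    (h : ∀ v, Measurable fun a => edist (Φ a) v) : Measurable Φ := by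
  refine measurable_of_isOpen fun U hU => ?_
  let ι := {q : E × ℝ≥0∞ // Metric.eball q.1 q.2 ⊆ U}
  obtain ⟨T, hT, hTU⟩ := TopologicalSpace.isOpen_iUnion_countable
    (fun i : ι => Metric.eball i.1.1 i.1.2) fun i => Metric.isOpen_eball
  have hU' : U = ⋃ i ∈ T, Metric.eball i.1.1 i.1.2 := by
    rw [hTU]
    refine Set.Subset.antisymm (fun v hv => ?_) (Set.iUnion_subset fun i => i.2)
    obtain ⟨ε, hε, hεU⟩ := EMetric.isOpen_iff.1 hU v hv
    exact Set.mem_iUnion.2 ⟨⟨(v, ε), hεU⟩, Metric.mem_eball_self hε⟩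
  rw [hU', Set.preimage_iUnion₂]
  exact MeasurableSet.biUnion hT fun i _ => h i.1.1 measurableSet_Iio

/-- A square integrable function on `X × Z` is a measurable map from `X` to `L²(Z)`. -/
theorem exists_measurable_curry {X Z : Type*} [MeasurableSpace X] [MeasurableSpace Z]
    {μ : Measure X} [SFinite μ] {m : Measure Z} [SFinite m]
    [MeasurableSpace (Lp ℝ 2 m)] [BorelSpace (Lp ℝ 2 m)] [SecondCountableTopology (Lp ℝ 2 m)]
    (h : Lp ℝ 2 (μ.prod m)) :
    ∃ Φ : X → Lp ℝ 2 m, Measurable Φ ∧ ∀ᵐ x ∂μ, ∀ᵐ u ∂m, Φ x u = h (x, u) := by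
  classical
  have hm : StronglyMeasurable (h : X × Z → ℝ) := Lp.stronglyMeasurable h
  have hsec : ∀ x, StronglyMeasurable fun u => h (x, u) := fun x =>
    hm.comp_measurable measurable_prodMk_left
  have hnorm : ∀ v : Z → ℝ, Measurable v →
      Measurable fun x => eLpNorm ((fun u => h (x, u)) - v) 2 m := by
    intro v hv
    simp only [eLpNorm_eq_lintegral_rpow_enorm_toReal two_ne_zero ENNReal.ofNat_ne_top,
      Pi.sub_apply]
    have h1 : Measurable fun q : X × Z => ‖h q - v q.2‖ₑ ^ (2 : ℝ≥0∞).toReal :=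
      (hm.measurable.sub (hv.comp measurable_snd)).enorm.pow_const _
    exact (h1.lintegral_prod_right').pow_const _
  have hnorm0 : Measurable fun x => eLpNorm (fun u => h (x, u)) 2 m := by
    simpa using hnorm 0 measurable_const
  have hset : MeasurableSet {x | MemLp (fun u => h (x, u)) 2 m} := by
    have : {x | MemLp (fun u => h (x, u)) 2 m} = {x | eLpNorm (fun u => h (x, u)) 2 m < ∞} := by
      ext x
      exact ⟨fun h => h.2, fun h => ⟨(hsec x).aestronglyMeasurable, h⟩⟩
    rw [this]
    exact hnorm0 measurableSet_Iio
  have hae : ∀ᵐ x ∂μ, MemLp (fun u => h (x, u)) 2 m := by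
    have h1 := (eLpNorm_lt_top_iff_lintegral_rpow_enorm_lt_top two_ne_zero
      ENNReal.ofNat_ne_top).1 (Lp.memLp h).2
    have h2 : Measurable fun q : X × Z => ‖h q‖ₑ ^ (2 : ℝ≥0∞).toReal :=
      hm.measurable.enorm.pow_const _
    rw [lintegral_prod _ h2.aemeasurable] at h1
    filter_upwards [ae_lt_top h2.lintegral_prod_right' h1.ne] with x hx
    exact ⟨(hsec x).aestronglyMeasurable,
      (eLpNorm_lt_top_iff_lintegral_rpow_enorm_lt_top two_ne_zero ENNReal.ofNat_ne_top).2 hx⟩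
  refine ⟨fun x => if hx : MemLp (fun u => h (x, u)) 2 m then hx.toLp _ else 0,
    measurable_of_measurable_edist fun v => ?_, ?_⟩
  · have : (fun x => edist (if hx : MemLp (fun u => h (x, u)) 2 m then hx.toLp _ else 0) v)
        = fun x => if MemLp (fun u => h (x, u)) 2 m then eLpNorm ((fun u => h (x, u)) - ⇑v) 2 m
          else edist 0 v := by
      funext x
      split_ifs with hx
      · rw [Lp.edist_def]
        exact eLpNorm_congr_ae (hx.coeFn_toLp.sub (ae_eq_refl _))
      · rfl
    rw [this]
    exact Measurable.ite hset (hnorm v (Lp.stronglyMeasurable v).measurable) measurable_const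
  · filter_upwards [hae] with x hx
    simp only [hx, dif_pos]
    exact hx.coeFn_toLp

/-! ### Reduction to a compact group -/

section Reduction

variable {Y X G : Type*} [MeasurableSpace Y] [MeasurableSpace X]
  [MeasurableSpace.CountablyGenerated X]
  [Group G] [TopologicalSpace G] [IsTopologicalGroup G] [LocallyCompactSpace G] [T2Space G]
  [SecondCountableTopology G] [MeasurableSpace G] [BorelSpace G]
  {p : Measure Y} [IsProbabilityMeasure p] {μ : Measure X} [IsProbabilityMeasure μ]
  {f : Y → X → X} {A : Y → X → G}

theorem measurePreserving_fiberTranslation {P : X → G} (hP : Measurable P) :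
    MeasurePreserving (fun z : X × G => (z.1, P z.1 * z.2))
      (μ.prod (Measure.haar : Measure G)) (μ.prod Measure.haar) :=
  (MeasurePreserving.id μ).skew_product (g := fun x u => P x * u)
    ((hP.comp measurable_fst).mul measurable_snd)
    (Eventually.of_forall fun _ => map_mul_left_eq_self _ _)

/-- The curried form of an invariant function is equivariant. -/
theorem ae_smul_curry_eq (hA : IsRandomCocycle p μ f A)
    {h : Lp ℝ 2 (μ.prod (Measure.haar : Measure G))}
    (hh : h ∈ invariantL2 hA.measurePreserving_haar)
    {Φ : X → Lp ℝ 2 (Measure.haar : Measure G)}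
    (hΦ : ∀ᵐ x ∂μ, ∀ᵐ u ∂(Measure.haar : Measure G), Φ x u = h (x, u)) :
    ∀ᵐ q ∂(p.prod μ), DomMulAct.mk (A q.1 q.2) • Φ (f q.1 q.2) = Φ q.2 := by
  rw [mem_invariantL2_iff] at hh
  have hh1 := Measure.ae_ae_of_ae_prod ((measurePreserving_prodAssoc p μ
    (Measure.haar : Measure G)).quasiMeasurePreserving.ae hh)
  have h2 := (measurePreserving_snd (μ := p) (ν := μ)).quasiMeasurePreserving.ae hΦ
  have h3 := hA.base.measurePreserving.quasiMeasurePreserving.ae hΦ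
  filter_upwards [hh1, h2, h3] with q a b c
  refine Lp.ext ?_
  have c' := (measurePreserving_mul_left (Measure.haar : Measure G)
    (A q.1 q.2)).quasiMeasurePreserving.ae c
  filter_upwards [a, b, c', DomMulAct.smul_Lp_ae_eq (DomMulAct.mk (A q.1 q.2)) (Φ (f q.1 q.2))]
    with u a b c d
  rw [d, b]
  exact c.trans a

/-- An essentially bounded cocycle is cohomologous to one with values in a compact subgroup `H`,
by a transfer map `P` which simultaneously makes every invariant function on the skew product
independent of `x`, and invariant under left translation by `H`. -/
theorem EssentiallyBounded.exists_reduction (hA : IsRandomCocycle p μ f A)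
    (hb : EssentiallyBounded p μ f A) :
    ∃ H : Subgroup G, IsCompact (H : Set G) ∧ ∃ P : X → G, Measurable P ∧
      (∀ᵐ q ∂(p.prod μ), (P (f q.1 q.2))⁻¹ * A q.1 q.2 * P q.2 ∈ H) ∧
      ∀ k ∈ invariantL2 hA.measurePreserving_haar, ∃ ψ : Lp ℝ 2 (Measure.haar : Measure G),
        (∀ b ∈ H, DomMulAct.mk b • ψ = ψ) ∧
        ∀ᵐ z ∂(μ.prod (Measure.haar : Measure G)), k (z.1, P z.1 * z.2) = ψ z.2 := by
  have : Fact ((2 : ℝ≥0∞) ≠ ∞) := ⟨ENNReal.ofNat_ne_top⟩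
  let _ : MeasurableSpace (Lp ℝ 2 (Measure.haar : Measure G)) := borel _
  have : BorelSpace (Lp ℝ 2 (Measure.haar : Measure G)) := ⟨rfl⟩
  set I := invariantL2 hA.measurePreserving_haar with hI
  let h : ℕ → I := TopologicalSpace.denseSeq I
  have hcurry := fun j => exists_measurable_curry (h j : Lp ℝ 2 (μ.prod (Measure.haar : Measure G)))
  choose Φ' hΦ'm hΦ'h using hcurry
  let Φ : X → ℕ → Lp ℝ 2 (Measure.haar : Measure G) := fun x j => Φ' j x
  have hΦm : Measurable Φ := measurable_pi_iff.2 hΦ'm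
  let R : G → (ℕ → Lp ℝ 2 (Measure.haar : Measure G)) → ℕ → Lp ℝ 2 (Measure.haar : Measure G) :=
    fun g v => DomMulAct.mk g • v
  have hR : Continuous fun q : G × (ℕ → Lp ℝ 2 (Measure.haar : Measure G)) => R q.1 q.2 :=
    (DomMulAct.continuous_mk.comp continuous_fst).smul continuous_snd
  have hR1 : ∀ v, R 1 v = v := fun v => one_smul _ v
  have hRmul : ∀ a b v, R (a * b) v = R b (R a v) := fun a b v => mul_smul _ _ v
  have hequi : ∀ᵐ q ∂(p.prod μ), R (A q.1 q.2) (Φ (f q.1 q.2)) = Φ q.2 := by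
    have := ae_all_iff.2 fun j => ae_smul_curry_eq hA (h j).2 (hΦ'h j)
    filter_upwards [this] with q hq
    funext j
    exact hq j
  have hproper : ∀ v ∈ {v : ℕ → Lp ℝ 2 (Measure.haar : Measure G) | v ≠ 0}, ∀ w,
      ∃ U ∈ 𝓝 v, ∃ L : Set G, IsCompact L ∧ ∀ g, R g w ∈ U → g ∈ L := by
    intro v hv w
    obtain ⟨j, hj⟩ := Function.ne_iff.1 hv
    obtain ⟨L, hL, hLg⟩ := exists_isCompact_of_norm_smul_sub_lt (v j) (w j) hj
    refine ⟨{y | ‖y j - v j‖ < ‖v j‖ / 2}, ?_, L, hL, fun g hg => hLg g hg⟩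
    refine IsOpen.mem_nhds (isOpen_lt (by fun_prop) continuous_const) ?_
    simpa using hj
  have hpos : μ.map Φ {v | v ≠ 0} ≠ 0 := by
    rw [Measure.map_apply hΦm isOpen_ne.measurableSet]
    intro h0
    have h1 : ∀ᵐ x ∂μ, Φ x = 0 := by simpa [ae_iff] using h0
    obtain ⟨k, hk, hk0⟩ := hb.exists_mem_invariantL2_ne_zero hA
    have hz : ∀ j, (h j : Lp ℝ 2 (μ.prod (Measure.haar : Measure G))) = 0 := by
      intro j
      refine (Lp.eq_zero_iff_ae_eq_zero).2 ?_
      refine (Measure.ae_prod_iff_ae_ae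
        ((Lp.stronglyMeasurable _).measurable (measurableSet_singleton 0))).2 ?_
      filter_upwards [h1, hΦ'h j] with x hx hx'
      have hx0 : Φ' j x = 0 := congrFun hx j
      filter_upwards [hx', Lp.coeFn_zero ℝ 2 (Measure.haar : Measure G)] with u hu hu0
      change (h j : Lp ℝ 2 (μ.prod (Measure.haar : Measure G))) (x, u) = 0
      rw [← hu, hx0, hu0]; rfl
    have hd : DenseRange h := TopologicalSpace.denseRange_denseSeq I
    have hcl : (⟨k, hk⟩ : I) ∈ closure (Set.range h) := hd _
    have hsub : Set.range h ⊆ {0} := by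
      rintro _ ⟨j, rfl⟩
      exact Subtype.ext (hz j)
    have := closure_minimal hsub isClosed_singleton hcl
    exact hk0 (congrArg Subtype.val this)
  obtain ⟨v₀, hv₀, P, hP, hPv⟩ := hA.base.exists_measurable_orbit_map R hR hR1 hRmul hΦm hequi
    hproper hpos
  let H : Subgroup G :=
    { carrier := {g | R g v₀ = v₀}
      mul_mem' := fun {a b} ha hb => by
        change R (a * b) v₀ = v₀
        rw [hRmul, show R a v₀ = v₀ from ha]; exact hb
      one_mem' := hR1 v₀
      inv_mem' := fun {a} ha => by
        change R a⁻¹ v₀ = v₀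
        conv_lhs => rw [← show R a v₀ = v₀ from ha]
        rw [← hRmul, mul_inv_cancel, hR1] }
  have hHmem : ∀ g, g ∈ H ↔ R g v₀ = v₀ := fun g => Iff.rfl
  refine ⟨H, ?_, P, hP, ?_, ?_⟩
  · obtain ⟨U, hU, L, hL, hLg⟩ := hproper v₀ hv₀ v₀
    refine hL.of_isClosed_subset ?_ fun g hg => hLg g ?_
    · exact isClosed_eq (hR.comp (continuous_id.prodMk continuous_const)) continuous_const
    · rw [(hHmem g).1 hg]; exact mem_of_mem_nhds hU
  · have h2 := (measurePreserving_snd (μ := p) (ν := μ)).quasiMeasurePreserving.ae hPv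
    have h3 := hA.base.measurePreserving.quasiMeasurePreserving.ae hPv
    filter_upwards [hequi, h2, h3] with q a b c
    rw [hHmem]
    conv_lhs => rw [← c]
    rw [hRmul, hRmul, ← hRmul (P (f q.1 q.2)), mul_inv_cancel, hR1, a, b]
  · -- The functions of the desired form make up a closed set containing the dense sequence `h`.
    let Q := Lp.compMeasurePreserving (E := ℝ) (p := 2) _
      (measurePreserving_fiberTranslation (μ := μ) hP)
    let J := Lp.compMeasurePreserving (E := ℝ) (p := 2) Prod.snd
      (measurePreserving_snd (μ := μ) (ν := (Measure.haar : Measure G)))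
    let Fix : Set (Lp ℝ 2 (Measure.haar : Measure G)) := {ψ | ∀ b ∈ H, DomMulAct.mk b • ψ = ψ}
    have hFix : IsClosed Fix := by
      have : Fix = ⋂ b ∈ H, {ψ | DomMulAct.mk b • ψ = ψ} := by ext; simp [Fix]
      rw [this]
      exact isClosed_biInter fun b _ => isClosed_eq (continuous_const_smul _) continuous_id
    have hclosed : IsClosed (Q ⁻¹' (J '' Fix)) :=
      ((Lp.isometry_compMeasurePreserving _).isClosedEmbedding.isClosedMap _ hFix).preimage
        (Lp.isometry_compMeasurePreserving _).continuous
    have hmem : ∀ j, (h j : Lp ℝ 2 (μ.prod (Measure.haar : Measure G))) ∈ Q ⁻¹' (J '' Fix) := by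
      intro j
      refine ⟨v₀ j, fun b hb => congrFun ((hHmem b).1 hb) j, Lp.ext ?_⟩
      refine (Lp.coeFn_compMeasurePreserving _ _).trans
        (EventuallyEq.symm ((Lp.coeFn_compMeasurePreserving _ _).trans ?_))
      have hms : MeasurableSet {z : X × G | (h j : Lp ℝ 2 (μ.prod (Measure.haar : Measure G)))
          (z.1, P z.1 * z.2) = v₀ j z.2} :=
        measurableSet_eq_fun ((Lp.stronglyMeasurable _).measurable.comp
          (measurePreserving_fiberTranslation (μ := μ) hP).measurable)
          ((Lp.stronglyMeasurable _).measurable.comp measurable_snd)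
      refine (Measure.ae_prod_iff_ae_ae hms).2 ?_
      filter_upwards [hΦ'h j, hPv] with x hx hx'
      have h1 := (measurePreserving_mul_left (Measure.haar : Measure G)
        (P x)).quasiMeasurePreserving.ae hx
      have h2 := DomMulAct.smul_Lp_ae_eq (DomMulAct.mk (P x)) (Φ' j x)
      have h3 : DomMulAct.mk (P x) • Φ' j x = v₀ j := congrFun hx' j
      rw [h3] at h2
      filter_upwards [h1, h2] with u a b
      rw [b]
      exact a.symm
    intro k hk
    have hkC : k ∈ Q ⁻¹' (J '' Fix) := by
      have hd : DenseRange h := TopologicalSpace.denseRange_denseSeq I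
      have hcl : (⟨k, hk⟩ : I) ∈ closure (Set.range h) := hd _
      refine closure_minimal ?_ (hclosed.preimage continuous_subtype_val) hcl
      rintro _ ⟨j, rfl⟩
      exact hmem j
    obtain ⟨ψ, hψ, hψk⟩ := hkC
    refine ⟨ψ, hψ, ?_⟩
    have h1 := Lp.coeFn_compMeasurePreserving k (measurePreserving_fiberTranslation (μ := μ) hP)
    have h2 := Lp.coeFn_compMeasurePreserving ψ
      (measurePreserving_snd (μ := μ) (ν := (Measure.haar : Measure G)))
    have h3 := (Lp.ext_iff.1 hψk)
    filter_upwards [h1, h2, h3] with z a b c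
    exact (a.symm.trans c.symm).trans b

end Reduction

/-! ### Invariant densities -/

/-- A finite measure which is stationary for a random walk and dominated by an invariant measure
has an invariant, square integrable density. -/
theorem exists_density_mem_invariantL2 {Y Z : Type*} [MeasurableSpace Y] [MeasurableSpace Z]
    {p : Measure Y} [IsProbabilityMeasure p] {ρ : Measure Z} [SigmaFinite ρ] {F : Y → Z → Z}
    (hF : MeasurePreserving (fun q : Y × Z => F q.1 q.2) (p.prod ρ) ρ) {ν : Measure Z}
    [IsFiniteMeasure ν] (hνρ : ν ≤ ρ)
    (hν : MeasurePreserving (fun q : Y × Z => F q.1 q.2) (p.prod ν) ν) :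
    ∃ k ∈ invariantL2 hF, ν = ρ.withDensity fun z => ENNReal.ofReal (k z) := by
  have hac : ν ≪ ρ := Measure.absolutelyContinuous_of_le hνρ
  set d := ν.rnDeriv ρ with hd
  have hdm : Measurable d := Measure.measurable_rnDeriv ν ρ
  have hdν : ρ.withDensity d = ν := Measure.withDensity_rnDeriv_eq ν ρ hac
  have hd1 : d ≤ᵐ[ρ] 1 := Measure.rnDeriv_le_one_of_le hνρ
  have hdtop : ∀ᵐ z ∂ρ, d z < ∞ := Measure.rnDeriv_lt_top ν ρ
  set g : Z → ℝ := fun z => (d z).toReal with hg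
  have hgm : Measurable g := hdm.ennreal_toReal
  have hgint : Integrable g ρ := Measure.integrable_toReal_rnDeriv
  have hg2 : Integrable (fun z => g z ^ 2) ρ := by
    refine hgint.mono' (hgm.pow_const 2).aestronglyMeasurable ?_
    filter_upwards [hd1] with z hz
    have h0 : 0 ≤ g z := ENNReal.toReal_nonneg
    have h1 : g z ≤ 1 := ENNReal.toReal_le_of_le_ofReal zero_le_one (by simpa using hz)
    rw [Real.norm_of_nonneg (by positivity)]
    nlinarith
  have hgL : MemLp g 2 ρ := (memLp_two_iff_integrable_sq hgm.aestronglyMeasurable).2 hg2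
  have hk : (hgL.toLp g : Z → ℝ) =ᵐ[ρ] g := hgL.coeFn_toLp
  refine ⟨hgL.toLp g, mem_invariantL2_of_inner_eq hF ?_, ?_⟩
  · have hnorm : ‖hgL.toLp g‖ ^ 2 = ∫ z, g z ∂ν := by
      rw [← real_inner_self_eq_norm_sq, L2.inner_def, ← integral_rnDeriv_smul hac]
      refine integral_congr_ae ?_
      filter_upwards [hk] with z hz
      rw [hz]
      simp [hg, hd, sq]
    rw [hnorm, L2.inner_def]
    have hprod : p.prod ν = (p.prod ρ).withDensity fun q => d q.2 := by
      rw [← prod_withDensity_right hdm, hdν]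
    have h1 := (measurePreserving_snd (μ := p) (ν := ρ)).quasiMeasurePreserving.ae hdtop
    have h2 : ∫ q, g (F q.1 q.2) ∂(p.prod ν) = ∫ z, g z ∂ν := by
      conv_rhs => rw [← hν.map_eq]
      rw [integral_map hν.measurable.aemeasurable hgm.aestronglyMeasurable]
    have hd2 : Measurable fun q : Y × Z => d q.2 := hdm.comp measurable_snd
    rw [← h2, hprod, integral_withDensity_eq_integral_toReal_smul hd2 h1]
    refine integral_congr_ae ?_
    filter_upwards [Lp.coeFn_compMeasurePreserving (hgL.toLp g) hF,
      Lp.coeFn_compMeasurePreserving (hgL.toLp g) (measurePreserving_snd (μ := p) (ν := ρ)),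
      hF.quasiMeasurePreserving.ae hk,
      (measurePreserving_snd (μ := p) (ν := ρ)).quasiMeasurePreserving.ae hk] with q a b c e
    rw [a, b, Function.comp_apply, Function.comp_apply, c, e]
    simp [hg]
  · rw [← hdν]
    refine withDensity_congr_ae ?_
    filter_upwards [hk, hdtop] with z hz hz'
    rw [hz, hg, ENNReal.ofReal_toReal hz'.ne]

/-! ### Smoothing of measures by right translations -/

section Smoothing

variable {Y X G : Type*} [MeasurableSpace Y] [MeasurableSpace X]
  [Group G] [TopologicalSpace G] [IsTopologicalGroup G] [LocallyCompactSpace G] [T2Space G]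
  [SecondCountableTopology G] [MeasurableSpace G] [BorelSpace G]
  {p : Measure Y} [IsProbabilityMeasure p] {μ : Measure X} [IsProbabilityMeasure μ]
  {f : Y → X → X} {A : Y → X → G}

/-- Convolution from the right, in the second factor of `X × G`, of a measure with the restriction
of Haar measure to `V`. -/
def smoothing (π : Measure (X × G)) (V : Set G) : Measure (X × G) :=
  (π.prod ((Measure.haar : Measure G).restrict V)).map fun q => (q.1.1, q.1.2 * q.2)

theorem measurable_rightTranslate :
    Measurable fun q : (X × G) × G => (q.1.1, q.1.2 * q.2) :=
  (measurable_fst.comp measurable_fst).prodMk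
    ((measurable_snd.comp measurable_fst).mul measurable_snd)

theorem isFiniteMeasure_smoothing (π : Measure (X × G)) [IsFiniteMeasure π] {V : Set G}
    (hV : Measure.haar V < ∞) : IsFiniteMeasure (smoothing π V) := by
  have : Fact ((Measure.haar : Measure G) V < ∞) := ⟨hV⟩
  unfold smoothing
  infer_instance

/-- Left invariance of Haar measure: translating `h` by the element `g` of `(x, g h)` changes
nothing, so only the projection of `π` on `X` matters. -/
theorem smoothing_le {π : Measure (X × G)} [IsProbabilityMeasure π] (hπ : π.map Prod.fst = μ)
    (V : Set G) : smoothing π V ≤ μ.prod Measure.haar := by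
  refine Measure.le_iff.2 fun S hS => ?_
  have hpre := measurable_rightTranslate (X := X) (G := G) hS
  rw [smoothing, Measure.map_apply measurable_rightTranslate hS, Measure.prod_apply hpre,
    Measure.prod_apply hS, ← hπ,
    lintegral_map (measurable_measure_prodMk_left hS) measurable_fst]
  refine lintegral_mono fun z => (Measure.restrict_apply_le V _).trans (le_of_eq ?_)
  exact measure_preimage_mul (Measure.haar : Measure G) z.2 (Prod.mk z.1 ⁻¹' S)

theorem smoothing_apply (π : Measure (X × G)) [SFinite π] {V : Set G} {S : Set (X × G)}
    (hS : MeasurableSet S) :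
    smoothing π V S = ∫⁻ h in V, π.map (fun z => (z.1, z.2 * h)) S ∂Measure.haar := by
  have hpre := measurable_rightTranslate (X := X) (G := G) hS
  rw [smoothing, Measure.map_apply measurable_rightTranslate hS, Measure.prod_apply_symm hpre]
  refine lintegral_congr fun h => ?_
  rw [Measure.map_apply (measurable_fst.prodMk (measurable_snd.mul_const h)) hS]
  rfl

/-- A finite measure is determined by its smoothings: two measures with the same smoothings have
the same right translate by almost every element of the group, and one element is enough. -/
theorem eq_of_forall_smoothing_eq [MeasurableSpace.CountablyGenerated X]
    {π₁ π₂ : Measure (X × G)} [IsFiniteMeasure π₁] [IsFiniteMeasure π₂]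
    (h : ∀ V : Set G, MeasurableSet V → Measure.haar V < ∞ → smoothing π₁ V = smoothing π₂ V) :
    π₁ = π₂ := by
  have hm : ∀ h : G, Measurable fun z : X × G => (z.1, z.2 * h) := fun h =>
    measurable_fst.prodMk (measurable_snd.mul_const h)
  have hmeas : ∀ (π : Measure (X × G)) [IsFiniteMeasure π] {S : Set (X × G)}, MeasurableSet S →
      Measurable fun h : G => π.map (fun z => (z.1, z.2 * h)) S := by
    intro π _ S hS
    simp only [Measure.map_apply (hm _) hS]
    exact measurable_measure_prodMk_right (measurable_rightTranslate hS)
  have key : ∀ᵐ h ∂(Measure.haar : Measure G), π₁.map (fun z => (z.1, z.2 * h))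
      = π₂.map (fun z => (z.1, z.2 * h)) := by
    refine ae_measure_eq_of_forall_ae_apply_eq (fun h => inferInstance) fun S hS => ?_
    refine ae_eq_of_forall_setLIntegral_eq_of_sigmaFinite (hmeas π₁ hS) (hmeas π₂ hS)
      fun V hV hV' => ?_
    rw [← smoothing_apply π₁ hS, ← smoothing_apply π₂ hS, h V hV hV']
  obtain ⟨h, hh⟩ := key.exists
  have := congrArg (Measure.map fun z : X × G => (z.1, z.2 * h⁻¹)) hh
  rw [Measure.map_map (hm _) (hm _), Measure.map_map (hm _) (hm _)] at this
  simpa [Function.comp_def] using this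

theorem IsStationary.measurePreserving_smoothing (hA : IsRandomCocycle p μ f A)
    {π : Measure (X × G)} [IsProbabilityMeasure π] (hπ : IsStationary p μ f A π) (V : Set G) :
    MeasurePreserving (fun q : Y × (X × G) => skewMap f A q.1 q.2)
      (p.prod (smoothing π V)) (smoothing π V) := by
  have hF := hA.measurable_skewMap
  set m := (Measure.haar : Measure G).restrict V
  have h1 : MeasurePreserving (fun q : (X × G) × G => (q.1.1, q.1.2 * q.2)) (π.prod m)
      (smoothing π V) := ⟨measurable_rightTranslate, rfl⟩
  have : SFinite (smoothing π V) := by unfold smoothing; infer_instance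
  have h2 : MeasurePreserving (Prod.map id fun q : (X × G) × G => (q.1.1, q.1.2 * q.2))
      (p.prod (π.prod m)) (p.prod (smoothing π V)) := (MeasurePreserving.id p).prod h1
  have h3 : MeasurePreserving (fun q : Y × ((X × G) × G) => (skewMap f A q.1 q.2.1, q.2.2))
      (p.prod (π.prod m)) (π.prod m) :=
    ((hπ.measurePreserving hA).prod (MeasurePreserving.id m)).comp
      ((measurePreserving_prodAssoc p π m).symm MeasurableEquiv.prodAssoc)
  refine ⟨hF, ?_⟩
  rw [← h2.map_eq, Measure.map_map hF h2.measurable, ← (h1.comp h3).map_eq]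
  congr 1
  funext q
  simp [skewMap, mul_assoc]

/-- If all invariant functions on the skew product are functions on `G` which are invariant under
left translation by `H`, then every stationary probability measure is the product of `μ` and a
measure which is invariant under left translation by `H`. -/
theorem IsStationary.eq_prod [MeasurableSpace.CountablyGenerated X]
    (hA : IsRandomCocycle p μ f A) {H : Subgroup G}
    (hinv : ∀ k ∈ invariantL2 hA.measurePreserving_haar,
      ∃ ψ : Lp ℝ 2 (Measure.haar : Measure G), (∀ b ∈ H, DomMulAct.mk b • ψ = ψ) ∧
        ∀ᵐ z ∂(μ.prod (Measure.haar : Measure G)), k z = ψ z.2)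
    {π : Measure (X × G)} [IsProbabilityMeasure π] (hπ : IsStationary p μ f A π) :
    π = μ.prod (π.map Prod.snd) ∧
      ∀ b ∈ H, (π.map Prod.snd).map (b * ·) = π.map Prod.snd := by
  have hsmooth : ∀ V : Set G, Measure.haar V < ∞ → ∃ ω : Measure G, SFinite ω ∧
      smoothing π V = μ.prod ω ∧ ∀ b ∈ H, ω.map (b * ·) = ω := by
    intro V hV
    have := isFiniteMeasure_smoothing π hV
    obtain ⟨k, hk, hkV⟩ := exists_density_mem_invariantL2 hA.measurePreserving_haar
      (smoothing_le hπ.proj V) (hπ.measurePreserving_smoothing hA V)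
    obtain ⟨ψ, hψ, hψk⟩ := hinv k hk
    have hψm : Measurable fun u => ENNReal.ofReal (ψ u) :=
      (Lp.stronglyMeasurable ψ).measurable.ennreal_ofReal
    refine ⟨Measure.haar.withDensity fun u => ENNReal.ofReal (ψ u), inferInstance, ?_, ?_⟩
    · rw [hkV, prod_withDensity_right hψm]
      refine withDensity_congr_ae ?_
      filter_upwards [hψk] with z hz
      rw [hz]
    · intro b hb
      have hbψ := DomMulAct.smul_Lp_ae_eq (DomMulAct.mk b) ψ
      rw [hψ b hb] at hbψ
      have hmp := measurePreserving_mul_left (Measure.haar : Measure G) b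
      refine Measure.ext fun S hS => ?_
      rw [Measure.map_apply hmp.measurable hS, withDensity_apply _ hS,
        withDensity_apply _ (hmp.measurable hS),
        ← hmp.setLIntegral_comp_preimage hS hψm]
      refine lintegral_congr_ae (ae_restrict_of_ae ?_)
      filter_upwards [hbψ] with u hu
      rw [hu]; rfl
  constructor
  · refine eq_of_forall_smoothing_eq fun V _ hV => ?_
    obtain ⟨ω, hω, hVω, -⟩ := hsmooth V hV
    have hmul : Measurable fun q : G × G => q.1 * q.2 := measurable_mul
    set m := (Measure.haar : Measure G).restrict V
    have h1 : ((π.map Prod.snd).prod m).map (fun q : G × G => q.1 * q.2) = ω := by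
      have : (μ.prod ω).map Prod.snd = ω := by rw [Measure.map_snd_prod]; simp
      rw [← this, ← hVω, smoothing, Measure.map_map measurable_snd measurable_rightTranslate,
        ← Measure.map_id (μ := m), Measure.map_prod_map _ _ measurable_snd measurable_id,
        Measure.map_map hmul (measurable_snd.prodMap measurable_id)]
      rfl
    have h2 := ((MeasurePreserving.id μ).prod (⟨hmul, h1⟩ : MeasurePreserving _ _ ω)).comp
      (measurePreserving_prodAssoc μ (π.map Prod.snd) m)
    rw [hVω, ← h2.map_eq]
    rfl
  · intro b hb
    have hm : Measurable fun z : X × G => (z.1, b * z.2) :=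
      measurable_fst.prodMk (measurable_snd.const_mul b)
    have hmb : Measurable fun u : G => b * u := measurable_const_mul b
    have hπb : π.map (fun z => (z.1, b * z.2)) = π := by
      have : IsFiniteMeasure (π.map fun z : X × G => (z.1, b * z.2)) := inferInstance
      refine eq_of_forall_smoothing_eq fun V _ hV => ?_
      obtain ⟨ω, hω, hVω, hωb⟩ := hsmooth V hV
      set m := (Measure.haar : Measure G).restrict V
      have h1 : smoothing (π.map fun z => (z.1, b * z.2)) V
          = (smoothing π V).map fun z => (z.1, b * z.2) := by
        rw [smoothing, smoothing, Measure.map_map hm measurable_rightTranslate]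
        conv_lhs => rw [show (Measure.haar : Measure G).restrict V = m.map id by
          rw [Measure.map_id]]
        rw [Measure.map_prod_map _ _ hm measurable_id,
          Measure.map_map measurable_rightTranslate (hm.prodMap measurable_id)]
        congr 1
        funext q
        simp [mul_assoc]
      rw [h1, hVω]
      have h2 := (MeasurePreserving.id μ).prod
        (⟨hmb, hωb b hb⟩ : MeasurePreserving (b * ·) ω ω)
      exact h2.map_eq
    conv_rhs => rw [← hπb]
    rw [Measure.map_map hmb measurable_snd, Measure.map_map measurable_snd hm]
    rfl

end Smoothing

/-! ### Transport along a cohomology -/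

section Transport

variable {Y X G : Type*} [MeasurableSpace Y] [MeasurableSpace X]
  [Group G] [MeasurableSpace G] [MeasurableMul₂ G]
  {p : Measure Y} [IsProbabilityMeasure p] {μ : Measure X} [IsProbabilityMeasure μ]
  {f : Y → X → X} {A B : Y → X → G} {P : X → G}

/-- Left translation by `P x` on the fibre `{x} × G`, as a map of `X × G`. -/
def fiberTranslation (P : X → G) (z : X × G) : X × G := (z.1, P z.1 * z.2)

theorem measurable_fiberTranslation (hP : Measurable P) : Measurable (fiberTranslation P) :=
  measurable_fst.prodMk ((hP.comp measurable_fst).mul measurable_snd)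

theorem fiberTranslation_inv_apply (P : X → G) (z : X × G) :
    fiberTranslation (fun x => (P x)⁻¹) (fiberTranslation P z) = z := by
  simp [fiberTranslation]

theorem fiberTranslation_apply_inv (P : X → G) (z : X × G) :
    fiberTranslation P (fiberTranslation (fun x => (P x)⁻¹) z) = z := by
  simp [fiberTranslation]

/-- A cohomology conjugates the skew products. -/
theorem ae_skewMap_fiberTranslation {π : Measure (X × G)} [SFinite π]
    (hπ : Measure.QuasiMeasurePreserving Prod.fst π μ)
    (h : ∀ᵐ q ∂(p.prod μ), P (f q.1 q.2) * B q.1 q.2 = A q.1 q.2 * P q.2) :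
    ∀ᵐ q ∂(p.prod π), skewMap f A q.1 (fiberTranslation P q.2)
      = fiberTranslation P (skewMap f B q.1 q.2) := by
  have hfst : Measure.QuasiMeasurePreserving (Prod.map id Prod.fst : Y × (X × G) → Y × X)
      (p.prod π) (p.prod μ) := MeasureTheory.QuasiMeasurePreserving.prodMap (.id p) hπ
  filter_upwards [hfst.ae h] with q hq
  have hq' : P (f q.1 q.2.1) * B q.1 q.2.1 = A q.1 q.2.1 * P q.2.1 := hq
  simp only [skewMap, fiberTranslation, smul_eq_mul, ← mul_assoc, hq']

theorem map_fst_map_fiberTranslation (hP : Measurable P) {π : Measure (X × G)}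
    (hπ : π.map Prod.fst = μ) : (π.map (fiberTranslation P)).map Prod.fst = μ := by
  rw [Measure.map_map measurable_fst (measurable_fiberTranslation hP)]
  exact hπ

theorem IsStationary.quasiMeasurePreserving_fst {π : Measure (X × G)}
    (hπ : IsStationary p μ f A π) : Measure.QuasiMeasurePreserving Prod.fst π μ :=
  (⟨measurable_fst, hπ.proj⟩ : MeasurePreserving _ _ _).quasiMeasurePreserving

theorem IsStationary.map_fiberTranslation (hA : IsRandomCocycle p μ f A)
    (hB : IsRandomCocycle p μ f B) (hP : Measurable P)
    (h : ∀ᵐ q ∂(p.prod μ), P (f q.1 q.2) * B q.1 q.2 = A q.1 q.2 * P q.2)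
    {π : Measure (X × G)} [SFinite π] (hπ : IsStationary p μ f B π) :
    IsStationary p μ f A (π.map (fiberTranslation P)) := by
  have hQ := measurable_fiberTranslation hP
  refine IsStationary.of_map_eq hA (map_fst_map_fiberTranslation hP hπ.proj) ?_
  have h1 : MeasurePreserving (Prod.map id (fiberTranslation P) : Y × (X × G) → Y × (X × G))
      (p.prod π) (p.prod (π.map (fiberTranslation P))) :=
    (MeasurePreserving.id p).prod ⟨hQ, rfl⟩
  rw [← h1.map_eq, Measure.map_map hA.measurable_skewMap h1.measurable]
  have hstat := hπ.measurePreserving hB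
  conv_rhs => rw [← hstat.map_eq, Measure.map_map hQ hstat.measurable]
  exact Measure.map_congr (ae_skewMap_fiberTranslation hπ.quasiMeasurePreserving_fst h)

theorem IsInvariant.map_fiberTranslation (hA : IsRandomCocycle p μ f A)
    (hB : IsRandomCocycle p μ f B) (hP : Measurable P)
    (h : ∀ᵐ q ∂(p.prod μ), P (f q.1 q.2) * B q.1 q.2 = A q.1 q.2 * P q.2)
    {π : Measure (X × G)} [SFinite π] (hπ : IsInvariant p μ f B π) :
    IsInvariant p μ f A (π.map (fiberTranslation P)) := by
  have hQ := measurable_fiberTranslation hP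
  refine ⟨map_fst_map_fiberTranslation hP hπ.proj, ?_⟩
  filter_upwards [hπ.invariant,
    Measure.ae_ae_of_ae_prod
      (ae_skewMap_fiberTranslation hπ.isStationary.quasiMeasurePreserving_fst h)] with i hi hi'
  have hAi : Measurable (skewMap f A i : X × G → X × G) :=
    hA.measurable_skewMap.comp (measurable_prodMk_left (x := i))
  have hBi : Measurable (skewMap f B i : X × G → X × G) :=
    hB.measurable_skewMap.comp (measurable_prodMk_left (x := i))
  rw [Measure.map_map hAi hQ]
  conv_rhs => rw [← hi, Measure.map_map hQ hBi]
  exact Measure.map_congr hi'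

end Transport

/-! ### Cocycles with values in a compact subgroup -/

section Compact

variable {Y X G : Type*} [MeasurableSpace Y] [MeasurableSpace X]
  [MeasurableSpace.CountablyGenerated X]
  [Group G] [TopologicalSpace G] [IsTopologicalGroup G] [LocallyCompactSpace G] [T2Space G]
  [SecondCountableTopology G] [MeasurableSpace G] [BorelSpace G]
  {p : Measure Y} [IsProbabilityMeasure p] {μ : Measure X} [IsProbabilityMeasure μ]
  {f : Y → X → X} {A B : Y → X → G} {P : X → G}

/-- Invariant functions for a cocycle yield invariant functions for a cohomologous one. -/
theorem exists_mem_invariantL2_comp_fiberTranslation (hA : IsRandomCocycle p μ f A)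
    (hB : IsRandomCocycle p μ f B) (hP : Measurable P)
    (h : ∀ᵐ q ∂(p.prod μ), P (f q.1 q.2) * B q.1 q.2 = A q.1 q.2 * P q.2)
    {k : Lp ℝ 2 (μ.prod (Measure.haar : Measure G))}
    (hk : k ∈ invariantL2 hA.measurePreserving_haar) :
    ∃ k' ∈ invariantL2 hB.measurePreserving_haar,
      ∀ᵐ z ∂(μ.prod (Measure.haar : Measure G)), k' z = k (fiberTranslation P z) := by
  have hQ : MeasurePreserving (fiberTranslation P) (μ.prod (Measure.haar : Measure G))
    (μ.prod Measure.haar) := measurePreserving_fiberTranslation hP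
  have hk' := Lp.coeFn_compMeasurePreserving k hQ
  refine ⟨Lp.compMeasurePreserving _ hQ k, ?_, hk'⟩
  rw [mem_invariantL2_iff] at hk ⊢
  filter_upwards [hB.measurePreserving_haar.quasiMeasurePreserving.ae hk',
    (measurePreserving_snd (μ := p) (ν := μ.prod Measure.haar)).quasiMeasurePreserving.ae hk',
    ((MeasurePreserving.id p).prod hQ).quasiMeasurePreserving.ae hk,
    ae_skewMap_fiberTranslation Measure.quasiMeasurePreserving_fst h] with q a b c d
  rw [a, b, Function.comp_apply, Function.comp_apply, ← d]
  exact c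

instance secondCountableTopology_subgroup (H : Subgroup G) : SecondCountableTopology H :=
  inferInstanceAs (SecondCountableTopology (H : Set G))

instance isProbabilityMeasure_haarProb (H : Type*) [Group H] [TopologicalSpace H]
    [IsTopologicalGroup H] [CompactSpace H] [MeasurableSpace H] [BorelSpace H] :
    IsProbabilityMeasure (haarProb H) :=
  ⟨by
    simpa [haarProb] using Measure.haarMeasure_self
      (K₀ := (⊤ : TopologicalSpace.PositiveCompacts H))⟩

theorem map_mul_left_haarProb {H : Type*} [Group H] [TopologicalSpace H]
    [IsTopologicalGroup H] [CompactSpace H] [MeasurableSpace H] [BorelSpace H] (b : H) :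
    (haarProb H).map (b * ·) = haarProb H :=
  map_mul_left_eq_self (Measure.haarMeasure ⊤) b

theorem eq_haarProb {H : Type*} [Group H] [TopologicalSpace H]
    [IsTopologicalGroup H] [CompactSpace H] [SecondCountableTopology H] [MeasurableSpace H]
    [BorelSpace H] {ω : Measure H} [IsProbabilityMeasure ω] (h : ∀ b, ω.map (b * ·) = ω) :
    ω = haarProb H := by
  have : ω.IsMulLeftInvariant := ⟨h⟩
  have key := Measure.haarMeasure_unique ω ⊤
  have h1 : ω ((⊤ : TopologicalSpace.PositiveCompacts H) : Set H) = 1 := by simp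
  rw [h1, one_smul] at key
  exact key

theorem haarProb_map_mconv {H : Subgroup G} [CompactSpace H] {ω : Measure G} [SFinite ω]
    (h : ∀ b ∈ H, ω.map (b * ·) = ω) :
    ((haarProb H).map Subtype.val).mconv ω = ω := by
  refine Measure.ext fun S hS => ?_
  have hpre : MeasurableSet ((fun q : G × G => q.1 * q.2) ⁻¹' S) := measurable_mul hS
  rw [Measure.mconv, Measure.map_apply measurable_mul hS, Measure.prod_apply hpre,
    lintegral_map (measurable_measure_prodMk_left hpre) measurable_subtype_coe]
  have : ∀ b : H, ω (Prod.mk (b : G) ⁻¹' ((fun q : G × G => q.1 * q.2) ⁻¹' S)) = ω S := by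
    intro b
    conv_rhs => rw [← h b b.2, Measure.map_apply (measurable_const_mul (b : G)) hS]
    rfl
  simp [this]

theorem IsRandomCocycle.coe {H : Subgroup G} {B : Y → X → H} (hB : IsRandomCocycle p μ f B) :
    IsRandomCocycle p μ f (fun i x => (B i x : G)) :=
  ⟨hB.base, measurable_subtype_coe.comp hB.measurable⟩

theorem IsRandomCocycle.isInvariant_prod {K : Type*} [Group K] [MeasurableSpace K]
    [MeasurableMul₂ K] {B : Y → X → K} (hB : IsRandomCocycle p μ f B) {ω : Measure K}
    [IsProbabilityMeasure ω] (hω : ∀ i x, ω.map (B i x * ·) = ω) :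
    IsInvariant p μ f B (μ.prod ω) :=
  ⟨by rw [Measure.map_fst_prod]; simp, hB.ae_map_skewMap_prod hω⟩

/-- Stationary measures on `X × H` are seen as stationary measures on `X × G`. -/
theorem IsStationary.map_coe {H : Subgroup G} {B : Y → X → H} (hB : IsRandomCocycle p μ f B)
    {π : Measure (X × H)} [SFinite π] (hπ : IsStationary p μ f B π) :
    IsStationary p μ f (fun i x => (B i x : G)) (π.map (Prod.map id Subtype.val)) := by
  have hι : Measurable (Prod.map id Subtype.val : X × H → X × G) :=
    measurable_id.prodMap measurable_subtype_coe
  refine IsStationary.of_map_eq hB.coe ?_ ?_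
  · rw [Measure.map_map measurable_fst hι]
    exact hπ.proj
  · have h1 : MeasurePreserving (Prod.map id (Prod.map id Subtype.val) :
        Y × (X × H) → Y × (X × G)) (p.prod π) (p.prod (π.map (Prod.map id Subtype.val))) :=
      (MeasurePreserving.id p).prod ⟨hι, rfl⟩
    have hstat := hπ.measurePreserving hB
    rw [← h1.map_eq, Measure.map_map hB.coe.measurable_skewMap h1.measurable]
    conv_rhs => rw [← hstat.map_eq, Measure.map_map hι hstat.measurable]
    rfl

/-- If the stationary measures on `X × G` are products with `H`-invariant measures, then the only
stationary probability measure on `X × H` is `μ × m_H`. -/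
theorem IsStationary.eq_prod_haarProb {H : Subgroup G} [CompactSpace H] {B : Y → X → H}
    (hB : IsRandomCocycle p μ f B)
    (hprod : ∀ π : Measure (X × G), IsProbabilityMeasure π →
      IsStationary p μ f (fun i x => (B i x : G)) π →
      π = μ.prod (π.map Prod.snd) ∧ ∀ b ∈ H, (π.map Prod.snd).map (b * ·) = π.map Prod.snd)
    {π : Measure (X × H)} [IsProbabilityMeasure π] (hπ : IsStationary p μ f B π) :
    π = μ.prod (haarProb H) := by
  have hHm : MeasurableSet (H : Set G) :=
    (isCompact_iff_compactSpace.2 ‹CompactSpace H›).isClosed.measurableSet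
  have hval : MeasurableEmbedding (Subtype.val : H → G) := MeasurableEmbedding.subtype_coe hHm
  have hι : MeasurableEmbedding (Prod.map id Subtype.val : X × H → X × G) :=
    MeasurableEmbedding.id.prodMap hval
  have : IsProbabilityMeasure (π.map (Prod.map id Subtype.val : X × H → X × G)) :=
    Measure.isProbabilityMeasure_map hι.measurable.aemeasurable
  have : IsProbabilityMeasure (π.map Prod.snd) :=
    Measure.isProbabilityMeasure_map measurable_snd.aemeasurable
  obtain ⟨h1, h2⟩ := hprod _ ‹_› (hπ.map_coe hB)
  have hsnd : (π.map (Prod.map id Subtype.val : X × H → X × G)).map Prod.snd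
      = (π.map Prod.snd).map Subtype.val := by
    rw [Measure.map_map measurable_snd hι.measurable, Measure.map_map hval.measurable
      measurable_snd]
    rfl
  rw [hsnd] at h1 h2
  have hω : π.map Prod.snd = haarProb H := by
    refine eq_haarProb fun b => hval.map_injective ?_
    have := h2 b b.2
    rw [Measure.map_map (measurable_const_mul (b : G)) hval.measurable] at this
    rw [Measure.map_map hval.measurable (measurable_const_mul b)]
    exact this
  rw [← hω]
  refine hι.map_injective (h1.trans ?_)
  rw [← Measure.map_prod_map _ _ measurable_id hval.measurable, Measure.map_id]

end Compact

end RandomCocycle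

end

theorem mainTheorem7
    {Y X G : Type*} [MeasurableSpace Y] [MeasurableSpace X] [StandardBorelSpace X]
    [Group G] [TopologicalSpace G] [IsTopologicalGroup G] [LocallyCompactSpace G] [T2Space G]
    [SecondCountableTopology G] [MeasurableSpace G] [BorelSpace G]
    (p : Measure Y) [IsProbabilityMeasure p] (μ : Measure X) [IsProbabilityMeasure μ]
    (f : Y → X → X) (A : Y → X → G)
    (hA : RandomCocycle.IsRandomCocycle p μ f A)
    (hbdd : RandomCocycle.EssentiallyBounded p μ f A) :
    (∃ (H : Subgroup G) (_ : CompactSpace H) (B : Y → X → H),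
      RandomCocycle.IsRandomCocycle p μ f B ∧
      RandomCocycle.Cohomologous p μ f A (fun i x => (B i x : G)) ∧
      -- the measure `μ × m_H` is the unique stationary probability measure on `X × H`
      RandomCocycle.IsStationary p μ f B (μ.prod (RandomCocycle.haarProb H)) ∧
      (∀ π : Measure (X × H), IsProbabilityMeasure π → RandomCocycle.IsStationary p μ f B π →
        π = μ.prod (RandomCocycle.haarProb H)) ∧
      RandomCocycle.IsInvariant p μ f B (μ.prod (RandomCocycle.haarProb H)) ∧
      -- stationary probability measures on `X × G`
      (∀ π : Measure (X × G), IsProbabilityMeasure π →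
        RandomCocycle.IsStationary p μ f (fun i x => (B i x : G)) π →
        (∃ ω : Measure G, IsProbabilityMeasure ω ∧
          π = μ.prod (((RandomCocycle.haarProb H).map Subtype.val).mconv ω)) ∧
        RandomCocycle.IsInvariant p μ f (fun i x => (B i x : G)) π)) ∧
    (∀ π : Measure (X × G), IsProbabilityMeasure π →
      RandomCocycle.IsStationary p μ f A π → RandomCocycle.IsInvariant p μ f A π) := by
  classical
  obtain ⟨H, hH, P, hP, hPH, hinv⟩ := hbdd.exists_reduction hA
  have hHc : CompactSpace H := isCompact_iff_compactSpace.1 hH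
  set C : Y → X → G := fun i x => (P (f i x))⁻¹ * A i x * P x with hC
  have hCm : Measurable fun q : Y × X => C q.1 q.2 :=
    ((hP.comp hA.base.measurable).inv.mul hA.measurable).mul (hP.comp measurable_snd)
  -- `C` takes values in `H` only almost everywhere.
  let B : Y → X → H := fun i x =>
    ⟨if C i x ∈ H then C i x else 1, by split_ifs with h; exacts [h, H.one_mem]⟩
  have hB : RandomCocycle.IsRandomCocycle p μ f B :=
    ⟨hA.base, (Measurable.ite (hCm hH.isClosed.measurableSet) hCm measurable_const).subtype_mk⟩
  have hBC : ∀ᵐ q ∂(p.prod μ), (B q.1 q.2 : G) = (P (f q.1 q.2))⁻¹ * A q.1 q.2 * P q.2 := by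
    filter_upwards [hPH] with q hq
    exact if_pos hq
  have hcoh : ∀ᵐ q ∂(p.prod μ), P (f q.1 q.2) * (B q.1 q.2 : G) = A q.1 q.2 * P q.2 := by
    filter_upwards [hBC] with q hq
    rw [hq]; group
  have hcoh' : ∀ᵐ q ∂(p.prod μ),
      (P (f q.1 q.2))⁻¹ * A q.1 q.2 = (B q.1 q.2 : G) * (P q.2)⁻¹ := by
    filter_upwards [hBC] with q hq
    rw [hq]; group
  have hprod : ∀ π : Measure (X × G), IsProbabilityMeasure π →
      RandomCocycle.IsStationary p μ f (fun i x => (B i x : G)) π →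
      π = μ.prod (π.map Prod.snd) ∧ ∀ b ∈ H, (π.map Prod.snd).map (b * ·) = π.map Prod.snd := by
    intro π _ hπ
    refine hπ.eq_prod hB.coe fun k hk => ?_
    obtain ⟨k', hk', hkk'⟩ := RandomCocycle.exists_mem_invariantL2_comp_fiberTranslation
      hB.coe hA hP.inv hcoh' hk
    obtain ⟨ψ, hψ, hψk⟩ := hinv k' hk'
    refine ⟨ψ, hψ, ?_⟩
    have hQ := RandomCocycle.measurePreserving_fiberTranslation (μ := μ) hP
    filter_upwards [hψk, hQ.quasiMeasurePreserving.ae hkk'] with z h1 h2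
    rw [← h1, h2]
    exact congrArg k (RandomCocycle.fiberTranslation_inv_apply P z).symm
  have hinvB : ∀ π : Measure (X × G), IsProbabilityMeasure π →
      RandomCocycle.IsStationary p μ f (fun i x => (B i x : G)) π →
      RandomCocycle.IsInvariant p μ f (fun i x => (B i x : G)) π := by
    intro π _ hπ
    have : IsProbabilityMeasure (π.map Prod.snd) :=
      Measure.isProbabilityMeasure_map measurable_snd.aemeasurable
    obtain ⟨h1, h2⟩ := hprod π ‹_› hπ
    rw [h1]
    exact hB.coe.isInvariant_prod fun i x => h2 _ (B i x).2
  have hHinv : RandomCocycle.IsInvariant p μ f B (μ.prod (RandomCocycle.haarProb H)) :=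
    hB.isInvariant_prod fun i x => RandomCocycle.map_mul_left_haarProb _
  refine ⟨⟨H, hHc, B, hB, ⟨P, hP, ?_⟩, hHinv.isStationary, fun π _ hπ => ?_, hHinv,
    fun π hπp hπ => ⟨⟨π.map Prod.snd, ?_, ?_⟩, hinvB π hπp hπ⟩⟩, fun π hπp hπ => ?_⟩
  · exact (RandomCocycle.measurePreserving_fst_coord p μ 0).quasiMeasurePreserving.ae hBC
  · exact hπ.eq_prod_haarProb hB hprod
  · exact Measure.isProbabilityMeasure_map measurable_snd.aemeasurable
  · rw [RandomCocycle.haarProb_map_mconv (hprod π hπp hπ).2]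
    exact (hprod π hπp hπ).1
  · have hπB := hπ.map_fiberTranslation hB.coe hA hP.inv hcoh'
    have hQ' := RandomCocycle.measurable_fiberTranslation (P := fun x => (P x)⁻¹) hP.inv
    have : IsProbabilityMeasure (π.map (RandomCocycle.fiberTranslation fun x => (P x)⁻¹)) :=
      Measure.isProbabilityMeasure_map hQ'.aemeasurable
    have key := (hinvB _ this hπB).map_fiberTranslation hA hB.coe hP hcoh
    rw [Measure.map_map (RandomCocycle.measurable_fiberTranslation hP) hQ'] at key
    convert key
    conv_lhs => rw [← Measure.map_id (μ := π)]
    congr 1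
    funext z
    exact (RandomCocycle.fiberTranslation_apply_inv P z).symm
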